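/- Let $K$ be a finite (Hausdorff) CW complex, $\mathbb{k}$ a field and $a,b\in\mathbb{R}$. A weight $w\colon K\to[a,b]$ is a function on the cells of $K$ such that $w(\sigma)\le w(\tau)$ whenever the cell $\sigma$ meets the closure of the cell $\tau$, so that each sublevel set $K^w_t=\{\sigma : w(\sigma)\le t\}$ is a subcomplex. Let $P=[a,2b-a]$. For $i\ge 0$ let $\operatorname{Dgm}_i(w)$ be the persistence diagram of the persistence module $t\mapsto H_i(K^w_t;\mathbb{k})$, $t\in P$ (cellular homology): the finite formal sum of the points $(\inf I_j,\sup I_j)$ for a decomposition $\bigoplus_j I_j$ into interval modules over $P$. For persistence modules $M,N$ over $P$ put $d_{\mathrm{rk}}(M,N)=\int_{\mathbb{R}^2}|\operatorname{rank}M-\operatorname{rank}N|$, where $\operatorname{rank}M(r,s)=\operatorname{rank}(M_r\to M_s)$ for $r\le s$ in $P$ and $0$ elsewhere. A diagram point $(x_1,x_2)$ stands for the interval module on $[x_1,x_2]\cap P$ and the diagonal $\Delta$ for the zero module. Let $W_1^{\mathrm{rk}}(\alpha,\beta)$ be the infimum, over all partial matchings of the points of $\alpha$ with those of $\beta$ (unmatched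 points being matched with $\Delta$), of the sum of the $d_{\mathrm{rk}}$-distances of matched points. For $x\in[a,b]$ let $I_x$ be the interval module on $[x,2b-a]$. **Proposition.** Let $w,v\colon K\to[a,b]$ be compatible weights, i.e. $w(\sigma)\le w(\tau)\Leftrightarrow v(\sigma)\le v(\tau)$ for all cells $\sigma,\tau$. Then all the diagrams $\operatorname{Dgm}_i(w)$, $\operatorname{Dgm}_i(v)$ exist, and $$\sum_{i\ge 0}W_1^{\mathrm{rk}}(\operatorname{Dgm}_i(w),\operatorname{Dgm}_i(v))\le\sum_{\sigma\in K}d_{\mathrm{rk}}(I_{w(\sigma)},I_{v(\sigma)}).$$ Moreover, there is a total order on the cells of $K$ along which $w$ and $v$ are nondecreasing and in which $\sigma$ does not come after $\tau$ whenever $\sigma$ meets the closure of $\tau$; and for every such total order and every $i\ge 0$, $$W_1^{\mathrm{rk}}(\operatorname{Dgm}_i(w),\operatorname{Dgm}_i(v))\le\sum_{\sigma}d_{\mathrm{rk}}(I_{w(\sigma)},I_{v(\sigma)}),$$ where $\sigma$ runs over the birth cells in degree $i$ (those for which $H_i(\{\rho:\rho<\sigma\})\to H_i(\{\rho:\rho\le\sigma\})$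 is not surjective) and the death cells in degree $i$ (those for which this map is not injective). -/

import Mathlib

open CategoryTheory MeasureTheory Metric
open scoped ENNReal

noncomputable section

namespace RankStability

universe u v

/-! ### Persistence modules over a subset of the real line -/

/-- A persistence module over the field `k`, indexed by the poset `P ⊆ ℝ`. -/
abbrev PersistenceModule (k : Type u) [Field k] (P : Set ℝ) := P ⥤ ModuleCat.{v} k

/-- The space at `t` of the interval module on `I`: it is `k` if `t ∈ I` and `0` otherwise. -/
def intervalSpace (k : Type u) [Field k] {P : Set ℝ} (I : Set P) (t : P) : Submodule k k where
  carrier := {x | t ∉ I → x = 0}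
  add_mem' := fun hx hy ht => by rw [hx ht, hy ht, add_zero]
  zero_mem' := fun _ => rfl
  smul_mem' := fun c x hx ht => by rw [hx ht, smul_zero]

open Classical in
/-- The structure maps of the interval module on `I`: the identity of `k` inside `I` and `0`
otherwise. -/
def intervalMap (k : Type u) [Field k] {P : Set ℝ} (I : Set P) (s t : P) :
    intervalSpace k I s →ₗ[k] intervalSpace k I t :=
  if ht : t ∈ I then
    (intervalSpace k I s).subtype.codRestrict (intervalSpace k I t) fun _ hn => absurd ht hn
  else 0

theorem intervalMap_self (k : Type u) [Field k] {P : Set ℝ} (I : Set P) (t : P) :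
    intervalMap k I t t = LinearMap.id := by
  refine LinearMap.ext fun x => Subtype.ext ?_
  by_cases ht : t ∈ I
  · simp [intervalMap, ht]
    rfl
  · have : (x : k) = 0 := x.2 ht
    simp [intervalMap, ht, this]

theorem intervalMap_comp (k : Type u) [Field k] {P : Set ℝ} (I : Set P) [hI : I.OrdConnected]
    {r s t : P} (hrs : r ≤ s) (hst : s ≤ t) :
    intervalMap k I r t = intervalMap k I s t ∘ₗ intervalMap k I r s := by
  refine LinearMap.ext fun x => Subtype.ext ?_
  by_cases ht : t ∈ I
  · by_cases hs : s ∈ I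
    · simp [intervalMap, ht, hs]
      rfl
    · have : (x : k) = 0 := x.2 fun hr => hs (hI.out hr ht ⟨hrs, hst⟩)
      simp [intervalMap, ht, hs]
      exact Subtype.ext this
  · simp [intervalMap, ht]

/-- The interval module on the (order-convex) set `I`. -/
def intervalModule (k : Type u) [Field k] {P : Set ℝ} (I : Set P) [hI : I.OrdConnected] :
    PersistenceModule.{u, u} k P where
  obj t := ModuleCat.of k (intervalSpace k I t)
  map {s t} _ := ModuleCat.ofHom (intervalMap k I s t)
  map_id t := by rw [intervalMap_self, ModuleCat.ofHom_id]
  map_comp {r s t} f g := by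
    rw [← ModuleCat.ofHom_comp, intervalMap_comp k I (leOfHom f) (leOfHom g)]

open Classical in
/-- The rank invariant `(r, s) ↦ rank (M_r → M_s)` for `r ≤ s` in `P`, extended by `0`. -/
def rankInvariant {k : Type u} [Field k] {P : Set ℝ} (M : PersistenceModule.{u, v} k P)
    (x : ℝ × ℝ) : ℕ :=
  if h : ∃ (_ : x.1 ∈ P) (_ : x.2 ∈ P), x.1 ≤ x.2 then
    Module.finrank k (LinearMap.range
      (M.map (homOfLE h.2.2 : (⟨x.1, h.1⟩ : P) ⟶ ⟨x.2, h.2.1⟩)).hom)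
  else 0

/-- `d_rk(M, N)`, the integral of `|rank M - rank N|` over the plane. -/
def dRk {k : Type u} [Field k] {P : Set ℝ} (M N : PersistenceModule.{u, v} k P) : ℝ≥0∞ :=
  ∫⁻ x : ℝ × ℝ, ENNReal.ofReal |(rankInvariant M x : ℝ) - (rankInvariant N x : ℝ)|

/-! ### Persistence diagrams and the Wasserstein distance -/

/-- `α` is the formal sum of the points `(inf I_j, sup I_j)` for some decomposition
`M ≅ ⨁_j I_j` of `M` into finitely many interval modules on nonempty intervals `I_j`. -/
def IsDiagram {k : Type u} [Field k] {P : Set ℝ} (M : PersistenceModule.{u, v} k P)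
    (α : Multiset (ℝ × ℝ)) : Prop :=
  ∃ (n : ℕ) (I : Fin n → Set P) (_ : ∀ j, (I j).OrdConnected) (_ : ∀ j, (I j).Nonempty)
    (e : ∀ t : P, M.obj t ≃ₗ[k] (∀ j, (intervalModule k (I j)).obj t)),
    (∀ (s t : P) (f : s ⟶ t) (x : M.obj s) (j : Fin n),
      e t ((M.map f).hom x) j = ((intervalModule k (I j)).map f).hom (e s x j)) ∧
    α = Finset.univ.val.map fun j =>
      (sInf ((fun t : P => (t : ℝ)) '' I j), sSup ((fun t : P => (t : ℝ)) '' I j))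

open Classical in
/-- The persistence diagram of `M` (unique if it exists, by uniqueness of interval
decompositions; `0` if `M` is not a finite direct sum of interval modules). -/
def dgm {k : Type u} [Field k] {P : Set ℝ} (M : PersistenceModule.{u, v} k P) :
    Multiset (ℝ × ℝ) :=
  if h : ∃ α, IsDiagram M α then h.choose else 0

/-- The interval represented by a point of the diagram plane; `none` stands for the diagonal `Δ`,
which represents the zero module. -/
def pointInterval (P : Set ℝ) : Option (ℝ × ℝ) → Set P
  | none => ∅
  | some x => {t | x.1 ≤ (t : ℝ) ∧ (t : ℝ) ≤ x.2}

instance (P : Set ℝ) (x : Option (ℝ × ℝ)) : (pointInterval P x).OrdConnected := by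
  cases x with
  | none => exact Set.ordConnected_empty
  | some x =>
    exact ⟨fun _ hr _ ht _ hs =>
      ⟨le_trans hr.1 (Subtype.coe_le_coe.2 hs.1), le_trans (Subtype.coe_le_coe.2 hs.2) ht.2⟩⟩

/-- `γ` is a coupling of the finite formal sums `α` and `β`: a formal sum of pairs `(x, y)`,
`(x, Δ)` and `(Δ, y)` in which the first entries make up `α` and the second entries `β`. -/
def IsCoupling (α β : Multiset (ℝ × ℝ)) (γ : Multiset (Option (ℝ × ℝ) × Option (ℝ × ℝ))) : Prop :=
  γ.filterMap Prod.fst = α ∧ γ.filterMap Prod.snd = β ∧ (none, none) ∉ γ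

/-- The cost of a coupling with respect to `d_rk`. -/
def cost (k : Type u) [Field k] (P : Set ℝ)
    (γ : Multiset (Option (ℝ × ℝ) × Option (ℝ × ℝ))) : ℝ≥0∞ :=
  (γ.map fun p =>
    dRk (intervalModule k (pointInterval P p.1)) (intervalModule k (pointInterval P p.2))).sum

/-- The 1-Wasserstein distance `W_1^rk` of finite persistence diagrams. -/
def W1 (k : Type u) [Field k] (P : Set ℝ) (α β : Multiset (ℝ × ℝ)) : ℝ≥0∞ :=
  ⨅ (γ : Multiset (Option (ℝ × ℝ) × Option (ℝ × ℝ))) (_ : IsCoupling α β γ), cost k P γ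

/-! ### The cellular chain complex of a finite CW complex -/

/-- The pole of the unit sphere of `ℝⁿ⁺¹` (sup norm). -/
def pole (n : ℕ) : Fin (n + 1) → ℝ := Fin.cons 1 0

/-- The vector that `pinch` normalizes. -/
def prePinch {n : ℕ} (u : Fin n → ℝ) : Fin (n + 1) → ℝ :=
  Fin.cons (2 * ‖u‖ - 1) ((1 - ‖u‖) • u)

/-- The map from the unit ball of `ℝⁿ` to the unit sphere of `ℝⁿ⁺¹` which maps the
boundary sphere to the pole and the open ball homeomorphically to the complement of the pole. -/
def pinch {n : ℕ} (u : Fin n → ℝ) : Fin (n + 1) → ℝ := ‖prePinch u‖⁻¹ • prePinch u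

theorem continuous_prePinch {n : ℕ} : Continuous (prePinch : (Fin n → ℝ) → _) := by
  refine continuous_pi fun i => ?_
  refine Fin.cases ?_ (fun j => ?_) i
  · simp only [prePinch, Fin.cons_zero]; fun_prop
  · simp only [prePinch, Fin.cons_succ, Pi.smul_apply]; fun_prop

theorem prePinch_ne_zero {n : ℕ} (u : Fin n → ℝ) : prePinch u ≠ 0 := by
  intro h
  have h0 : 2 * ‖u‖ - 1 = 0 := by simpa [prePinch] using congrFun h 0
  have hu : (1 - ‖u‖) • u = 0 := funext fun j => by simpa [prePinch] using congrFun h j.succ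
  rcases smul_eq_zero.1 hu with h1 | h1
  · linarith
  · rw [h1, norm_zero] at h0; linarith

theorem continuous_pinch {n : ℕ} : Continuous (pinch : (Fin n → ℝ) → _) :=
  (continuous_prePinch.norm.inv₀ fun u => norm_ne_zero_iff.2 (prePinch_ne_zero u)).smul
    continuous_prePinch

theorem norm_pinch {n : ℕ} (u : Fin n → ℝ) : ‖pinch u‖ = 1 := by
  rw [pinch, norm_smul, norm_inv, norm_norm,
    inv_mul_cancel₀ (norm_ne_zero_iff.2 (prePinch_ne_zero u))]

theorem norm_pole (n : ℕ) : ‖pole n‖ = 1 := by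
  refine le_antisymm ((pi_norm_le_iff_of_nonneg zero_le_one).2 fun i => ?_) ?_
  · refine Fin.cases ?_ (fun j => ?_) i <;> simp [pole]
  · simpa [pole] using norm_le_pi_norm (pole n) 0

theorem pinch_of_norm_eq_one {n : ℕ} {u : Fin n → ℝ} (hu : ‖u‖ = 1) : pinch u = pole n := by
  have : prePinch u = pole n := by
    rw [prePinch, pole, hu]; norm_num
  rw [pinch, this, norm_pole, inv_one, one_smul]

open Topology Topology.RelCWComplex

variable {X : Type v} [TopologicalSpace X] {C : Set X} [CWComplex C]

open Classical in
/-- The collapse of the complement of the open `n`-cell `σ` to a point, followed by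
the identification of the quotient `Dⁿ / ∂Dⁿ` with the unit sphere of `ℝⁿ⁺¹`. -/
def collapse (n : ℕ) (σ : cell C n) (x : X) : Fin (n + 1) → ℝ :=
  if x ∈ openCell n σ then pinch ((map n σ).symm x) else pole n

theorem norm_collapse (n : ℕ) (σ : cell C n) (x : X) : ‖collapse n σ x‖ = 1 := by
  unfold collapse; split_ifs
  · exact norm_pinch _
  · exact norm_pole _

theorem disjoint_openCell_cellFrontier [T2Space X] {m n : ℕ} (h : m ≤ n) (ρ : cell C m) (σ : cell C n) :
    Disjoint (openCell n σ) (cellFrontier m ρ) := by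
  have h1 : cellFrontier m ρ ⊆ (skeletonLT C m : Set X) := cellFrontier_subset_skeletonLT m ρ
  exact (disjoint_skeletonLT_openCell (C := C) (n := m) (j := σ) (by exact_mod_cast h)).symm.mono_right
    h1

theorem collapse_map [T2Space X] (n : ℕ) (σ : cell C n) {u : Fin n → ℝ} (hu : u ∈ closedBall 0 1) :
    collapse n σ (map n σ u) = pinch u := by
  rcases (mem_closedBall_zero_iff.1 hu).lt_or_eq with h | h
  · have hb : u ∈ ball (0 : Fin n → ℝ) 1 := mem_ball_zero_iff.2 h
    rw [collapse, if_pos ⟨u, hb, rfl⟩, (map n σ).left_inv (by rwa [source_eq])]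
  · have hf : map n σ u ∈ cellFrontier n σ := ⟨u, mem_sphere_zero_iff_norm.2 h, rfl⟩
    rw [collapse, if_neg, pinch_of_norm_eq_one h]
    exact fun ho => Set.disjoint_left.1 (disjoint_openCell_cellFrontier le_rfl σ σ) ho hf

theorem continuousOn_collapse_closedCell [T2Space X] (n : ℕ) (σ : cell C n) :
    ContinuousOn (collapse n σ) (closedCell n σ) := by
  rw [continuousOn_iff_isClosed]
  intro A hA
  refine ⟨map n σ '' (closedBall 0 1 ∩ pinch ⁻¹' A), ?_, ?_⟩
  · refine IsCompact.isClosed (IsCompact.image_of_continuousOn ?_ ?_)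
    · exact (isCompact_closedBall _ _).inter_right (hA.preimage continuous_pinch)
    · exact (RelCWComplex.continuousOn n σ).mono Set.inter_subset_left
  · ext x
    constructor
    · rintro ⟨hx, u, hu, rfl⟩
      refine ⟨⟨u, ⟨hu, ?_⟩, rfl⟩, ⟨u, hu, rfl⟩⟩
      rwa [Set.mem_preimage, collapse_map n σ hu] at hx
    · rintro ⟨⟨u, ⟨hu, hA⟩, rfl⟩, hx⟩
      refine ⟨?_, hx⟩
      rwa [Set.mem_preimage, collapse_map n σ hu]

theorem continuousOn_collapse_cellFrontier [T2Space X] (n : ℕ) (σ : cell C n)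
    (τ : cell C (n + 1)) : ContinuousOn (collapse n σ) (cellFrontier (n + 1) τ) := by
  obtain ⟨I, hI⟩ := CWComplex.cellFrontier_subset_finite_closedCell (C := C) (n + 1) τ
  let s : Set (Σ m, cell C m) := {ρ | ρ.1 < n + 1 ∧ ρ.2 ∈ I ρ.1 ∧ ρ ≠ ⟨n, σ⟩}
  have hs : s.Finite := by
    refine Set.Finite.subset
      ((Finset.range (n + 1)).sigma I).finite_toSet fun ρ hρ => ?_
    simpa using And.intro (Nat.lt_succ_iff.1 hρ.1) hρ.2.1
  let B : Set X := ⋃ ρ ∈ s, closedCell ρ.1 ρ.2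
  have hB : IsClosed B := hs.isClosed_biUnion fun ρ _ => isClosed_closedCell
  have hcB : ContinuousOn (collapse n σ) B := by
    refine (continuousOn_const (c := pole n)).congr fun x hx => ?_
    obtain ⟨ρ, hρ, hx⟩ := Set.mem_iUnion₂.1 hx
    refine if_neg fun hxσ => ?_
    rw [← cellFrontier_union_openCell_eq_closedCell] at hx
    rcases hx with hx | hx
    · exact Set.disjoint_left.1
        (disjoint_openCell_cellFrontier (Nat.lt_succ_iff.1 hρ.1) ρ.2 σ) hxσ hx
    · exact Set.disjoint_left.1 (disjoint_openCell_of_ne (i := ρ.2) (j := σ) hρ.2.2) hx hxσ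
  refine ((continuousOn_collapse_closedCell n σ).union_of_isClosed hcB
    isClosed_closedCell hB).mono fun x hx => ?_
  have hx' := hI hx
  simp only [Set.mem_iUnion] at hx'
  obtain ⟨m, hm, j, hj, hx'⟩ := hx'
  by_cases h : (⟨m, j⟩ : Σ m, cell C m) = ⟨n, σ⟩
  · obtain ⟨rfl, h⟩ := Sigma.mk.inj_iff.1 h
    obtain rfl := eq_of_heq h
    exact Or.inl hx'
  · exact Or.inr (Set.mem_iUnion₂.2 ⟨⟨m, j⟩, ⟨hm, hj, h⟩, hx'⟩)

/-- The map `Sⁿ → Cⁿ → Cⁿ / (Cⁿ ∖ σ) ≅ Sⁿ` given by the attaching map of the `(n+1)`-cell `τ`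
followed by the collapse onto the `n`-cell `σ`. -/
def attachingCollapse [T2Space X] (n : ℕ) (τ : cell C (n + 1)) (σ : cell C n) :
    C(sphere (0 : Fin (n + 1) → ℝ) 1, sphere (0 : Fin (n + 1) → ℝ) 1) where
  toFun x := ⟨collapse n σ (map (n + 1) τ x), mem_sphere_zero_iff_norm.2 (norm_collapse n σ _)⟩
  continuous_toFun := by
    refine Continuous.subtype_mk ?_ _
    refine ContinuousOn.comp_continuous (s := cellFrontier (n + 1) τ)
      (continuousOn_collapse_cellFrontier n σ τ) ?_ fun x => ⟨x, x.2, rfl⟩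
    exact ((RelCWComplex.continuousOn (n + 1) τ).mono sphere_subset_closedBall).comp_continuous
      continuous_subtype_val fun x => x.2

/-- The degree in `k` of a self-map `f` of the unit sphere `Sⁿ` of `ℝⁿ⁺¹`, for `n ≥ 1`:
the scalar by which `f` acts on the line `Hₙ(Sⁿ; k)`, computed as a trace. -/
def sphereDegree (k : Type u) [Field k] (n : ℕ)
    (f : C(sphere (0 : Fin (n + 1) → ℝ) 1, sphere (0 : Fin (n + 1) → ℝ) 1)) : k :=
  LinearMap.trace k _
    (((AlgebraicTopology.singularHomologyFunctor.{0} (ModuleCat.{u} k) n).obj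
      (ModuleCat.of k k)).map (TopCat.ofHom f)).hom

open Classical in
/-- The incidence number of the `(n+1)`-cell `τ` and the `n`-cell `σ` in the cellular boundary
formula: for an edge, `1` for its end point and `-1` for its starting point; in higher dimensions
the degree of the attaching map of `τ` collapsed onto `σ`. -/
def incidence (k : Type u) [Field k] [T2Space X] :
    (n : ℕ) → (τ : cell C (n + 1)) → (σ : cell C n) → k
  | 0, τ, σ => (if map 1 τ (fun _ => 1) ∈ openCell 0 σ then 1 else 0) -
      (if map 1 τ (fun _ => -1) ∈ openCell 0 σ then 1 else 0)
  | n + 1, τ, σ => sphereDegree k (n + 1) (attachingCollapse (n + 1) τ σ)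

variable (C) in
/-- The type of all cells of the complex. -/
abbrev Cells := Σ n, cell C n

/-- The cells that meet the closure of `τ`. A set of cells is the set of cells of a
subcomplex iff it is closed under this relation (for finite complexes); for regular complexes it
is inclusion of closed cells. -/
def IsFace (σ τ : Cells C) : Prop := (openCell σ.1 σ.2 ∩ closedCell τ.1 τ.2).Nonempty

variable (k : Type u) [Field k]

variable (C) in
/-- Cellular `n`-chains with coefficients in `k`. -/
abbrev Chains (n : ℕ) := cell C n →₀ k

instance [h : CWComplex.Finite C] (n : ℕ) : _root_.Finite (cell C n) := h.finite_cell n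

instance (n : ℕ) : AddCommGroup (Chains C k n) := Finsupp.instAddCommGroup

variable (C) in
/-- The cellular boundary map. -/
def boundary [T2Space X] [CWComplex.Finite C] (n : ℕ) : Chains C k (n + 1) →ₗ[k] Chains C k n :=
  Finsupp.linearCombination k fun τ => Finsupp.equivFunOnFinite.symm (incidence k n τ)

/-- The chains supported on the set `S` of cells. -/
def chainsOn (S : Set (Cells C)) (n : ℕ) : Submodule k (Chains C k n) :=
  Finsupp.supported k k {σ | (⟨n, σ⟩ : Cells C) ∈ S}

/-- The cycles supported on the set `S` of cells. -/
def cyclesOn [T2Space X] [CWComplex.Finite C] (S : Set (Cells C)) :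
    (n : ℕ) → Submodule k (Chains C k n)
  | 0 => chainsOn k S 0
  | n + 1 => chainsOn k S (n + 1) ⊓ LinearMap.ker (boundary C k n)

/-- The boundaries of chains supported on the set `S` of cells. -/
def boundariesOn [T2Space X] [CWComplex.Finite C] (S : Set (Cells C)) (n : ℕ) :
    Submodule k (Chains C k n) :=
  (chainsOn k S (n + 1)).map (boundary C k n)

theorem chainsOn_mono {S T : Set (Cells C)} (h : S ⊆ T) (n : ℕ) :
    chainsOn k S n ≤ chainsOn k T n :=
  Finsupp.supported_mono fun _ hσ => h hσ

theorem cyclesOn_mono [T2Space X] [CWComplex.Finite C] {S T : Set (Cells C)} (h : S ⊆ T) (n : ℕ) :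
    cyclesOn k S n ≤ cyclesOn k T n := by
  cases n with
  | zero => exact chainsOn_mono k h 0
  | succ n => exact inf_le_inf_right _ (chainsOn_mono k h (n + 1))

/-- The cellular homology `Hₙ(S; k)` (cycles modulo boundaries) of the subcomplex with set of
cells `S`. -/
abbrev Homology [T2Space X] [CWComplex.Finite C] (S : Set (Cells C)) (n : ℕ) :=
  cyclesOn k S n ⧸ (boundariesOn k S n).submoduleOf (cyclesOn k S n)

/-- The map in cellular homology induced by the inclusion of subcomplexes. -/
def homologyMap [T2Space X] [CWComplex.Finite C] {S T : Set (Cells C)} (h : S ⊆ T) (n : ℕ) :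
    Homology k S n →ₗ[k] Homology k T n :=
  Submodule.mapQ _ _ (Submodule.inclusion (cyclesOn_mono k h n))
    (fun _ hx => Submodule.map_mono (chainsOn_mono k h (n + 1)) hx)

/-! ### Weights and persistent homology -/

/-- `w` is a weight on the complex with values in `[a, b]`: an order-preserving map from its cells
to `[a, b]`. -/
def IsWeight (a b : ℝ) (w : Cells C → ℝ) : Prop :=
  (∀ σ, w σ ∈ Set.Icc a b) ∧ ∀ σ τ, IsFace σ τ → w σ ≤ w τ

/-- Two weights are compatible if they induce the same preorder on the cells. -/
def Compatible (w v : Cells C → ℝ) : Prop := ∀ σ τ, w σ ≤ w τ ↔ v σ ≤ v τ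

/-- The cells of the sublevel complex of `w` at `t`. -/
def sublevel (w : Cells C → ℝ) (t : ℝ) : Set (Cells C) := {σ | w σ ≤ t}

theorem sublevel_mono (w : Cells C → ℝ) {s t : ℝ} (h : s ≤ t) : sublevel w s ⊆ sublevel w t :=
  fun _ hσ => le_trans hσ h

/-- The persistent homology in degree `i` of the sublevel filtration of `w`, indexed by the
set `P` of parameters. -/
def persistentHomology [T2Space X] [CWComplex.Finite C] (P : Set ℝ) (w : Cells C → ℝ) (i : ℕ) :
    PersistenceModule.{u, max u v} k P where
  obj t := ModuleCat.of k (Homology k (sublevel w t) i)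
  map {s t} f := ModuleCat.ofHom (homologyMap k (sublevel_mono w (leOfHom f)) i)
  map_id t := by
    ext x
    rfl
  map_comp f g := by
    ext x
    rfl

/-- The range `[a, 2b - a]` of the filtration parameter for weights with values in `[a, b]`. -/
abbrev paramRange (a b : ℝ) : Set ℝ := Set.Icc a (2 * b - a)

/-- The diagram `Dgm_i(w)`. -/
def diagram [T2Space X] [CWComplex.Finite C] (P : Set ℝ) (w : Cells C → ℝ) (i : ℕ) :
    Multiset (ℝ × ℝ) :=
  dgm (persistentHomology k P w i)

/-- The free interval `[x, ∞) ∩ P`, generated at `x`. -/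
def freeInterval (P : Set ℝ) (x : ℝ) : Set P := {t | x ≤ (t : ℝ)}

instance (P : Set ℝ) (x : ℝ) : (freeInterval P x).OrdConnected :=
  ⟨fun _ hr _ _ _ hs => le_trans hr (Subtype.coe_le_coe.2 hs.1)⟩

/-- `d_rk(I_x, I_y)` for the free interval modules generated at `x` and at `y`. -/
def dRkFree (P : Set ℝ) (x y : ℝ) : ℝ≥0∞ :=
  dRk (intervalModule k (freeInterval P x)) (intervalModule k (freeInterval P y))

/-! ### Birth and death cells -/

/-- The total order `L` on the cells respects `w`: initial segments are subcomplexes, and `w` is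
nondecreasing along `L`. -/
def Respects (L : LinearOrder (Cells C)) (w : Cells C → ℝ) : Prop :=
  (∀ σ τ, IsFace σ τ → L.le σ τ) ∧ ∀ σ τ, L.le σ τ → w σ ≤ w τ

theorem initial_subset (L : LinearOrder (Cells C)) (σ : Cells C) :
    {ρ | L.lt ρ σ} ⊆ {ρ | L.le ρ σ} :=
  fun ρ h => @le_of_lt _ L.toPreorder ρ σ h

/-- `σ` is a birth cell in degree `i`: when the cells are added one at a time in the order `L`,
a new class appears in degree `i` with `σ`. -/
def IsBirthCell [T2Space X] [CWComplex.Finite C] (L : LinearOrder (Cells C)) (i : ℕ)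
    (σ : Cells C) : Prop :=
  ¬ Function.Surjective (homologyMap k (initial_subset L σ) i)

/-- `σ` is a death cell in degree `i`: when the cells are added one at a time in the order `L`,
a nonzero class in degree `i` becomes zero with `σ`. -/
def IsDeathCell [T2Space X] [CWComplex.Finite C] (L : LinearOrder (Cells C)) (i : ℕ)
    (σ : Cells C) : Prop :=
  ¬ Function.Injective (homologyMap k (initial_subset L σ) i)

end RankStability

end

noncomputable section

namespace RankStability

universe u v

/-! ### Uniqueness of persistence diagrams -/

section Uniqueness

variable {k : Type u} [Field k] {P : Set ℝ}

/-! Compatible weights are monotone along a common total order of the cells, built in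
`exists_respects`. Adding the cells one at a time along that order gives a pairing of birth cells
with death cells that does not depend on the weight. `IsCellwise.nonempty_pairing` produces cycles
`vec p`, one for each birth cell, that are adapted to all cycle and bounding-cycle spaces of initial
segments at once. Every sublevel set of a weight is an initial segment. Hence the module of `w`
splits into the bars from `w p` to `w q` (`q` the death cell of `p`), and that of `v` into the bars
from `v p` to `v q`. Compatible weights drop the same bars of zero length, so bars with the same
birth cell can be matched.

The rank function of a bar is the indicator of a triangle. Two such triangles differ inside a
vertical strip between the births and a horizontal strip between the deaths
(`dRk_pointInterval_le`). The vertical strip lies where the rank functions of the free intervals at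
the births differ. The horizontal one is no larger than the vertical strip between the deaths,
because all weights are at most `b` while the parameter range extends to `2 * b - a`
(`volume_heightStrip_le`).

It remains to count. A cell is charged at most once in each degree (`Pairing.death_injective`,
`Pairing.notMem_births`) and is a birth or death cell in at most one degree (`degree_unique`). -/

theorem intervalMap_apply_of_mem {I : Set P} {s t : P} (ht : t ∈ I) (x : intervalSpace k I s) :
    (intervalMap k I s t x : k) = x := by
  simp [intervalMap, ht]
  rfl

theorem intervalMap_eq_zero_iff {I : Set P} {s t : P} (x : intervalSpace k I s) :
    intervalMap k I s t x = 0 ↔ (t ∈ I → (x : k) = 0) := by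
  by_cases ht : t ∈ I
  · rw [← Subtype.coe_inj, intervalMap_apply_of_mem ht]
    simp [ht]
  · simp [intervalMap, ht]

/-- The rank of a structure map of a direct sum of interval modules is the number of intervals
containing both indices. -/
theorem finrank_range_of_decomposition {M : PersistenceModule.{u, v} k P} {ι : Type*} [Fintype ι]
    {I : ι → Set P} [hI : ∀ j, (I j).OrdConnected]
    (e : ∀ t : P, M.obj t ≃ₗ[k] (∀ j, (intervalModule k (I j)).obj t))
    (he : ∀ (s t : P) (f : s ⟶ t) (x : M.obj s) (j : ι),
      e t ((M.map f).hom x) j = ((intervalModule k (I j)).map f).hom (e s x j))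
    {s t : P} (f : s ⟶ t) :
    Module.finrank k (LinearMap.range (M.map f).hom) = Nat.card {j // s ∈ I j ∧ t ∈ I j} := by
  classical
  let c : ∀ j, (intervalModule k (I j)).obj s →ₗ[k] k := fun j => (intervalSpace k (I j) s).subtype
  -- `g` reads the coordinates on the intervals containing both `s` and `t`. It is onto and has the
  -- kernel of the structure map, so the rank is the dimension of its target.
  let g : M.obj s →ₗ[k] ({j // s ∈ I j ∧ t ∈ I j} → k) :=
    LinearMap.pi (fun j => c j.1 ∘ₗ LinearMap.proj j.1) ∘ₗ (e s).toLinearMap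
  have hg : Function.Surjective g := by
    intro y
    have h0 : ∃ z : ∀ j, (intervalModule k (I j)).obj s,
        ∀ j, c j (z j) = if h : s ∈ I j ∧ t ∈ I j then y ⟨j, h⟩ else 0 :=
      ⟨fun j => (⟨if h : s ∈ I j ∧ t ∈ I j then y ⟨j, h⟩ else 0,
        fun hs => dif_neg fun h => hs h.1⟩ : intervalSpace k (I j) s), fun j => rfl⟩
    obtain ⟨z, hz⟩ := h0
    obtain ⟨x, rfl⟩ := (e s).surjective z
    exact ⟨x, funext fun j => (hz j).trans (dif_pos j.2)⟩
  have hker : LinearMap.ker (M.map f).hom = LinearMap.ker g := by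
    ext x
    rw [LinearMap.mem_ker, LinearMap.mem_ker, ← (e t).map_eq_zero_iff, funext_iff, funext_iff]
    have h1 : ∀ j, e t ((M.map f).hom x) j = (0 : ∀ j, (intervalModule k (I j)).obj t) j ↔
        (t ∈ I j → c j (e s x j) = 0) := by
      intro j
      rw [he]
      exact intervalMap_eq_zero_iff (I := I j) (s := s) (t := t) (e s x j)
    simp only [h1, Subtype.forall]
    refine forall_congr' fun j => ⟨fun h hj => h hj.2, fun h ht => ?_⟩
    by_cases hs : s ∈ I j
    · exact h ⟨hs, ht⟩
    · exact (show intervalSpace k (I j) s from e s x j).2 hs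
  rw [← (LinearMap.quotKerEquivRange _).finrank_eq, hker,
    (LinearMap.quotKerEquivOfSurjective g hg).finrank_eq, Module.finrank_pi, Nat.card_eq_fintype_card]

end Uniqueness

/-! ### Finite multisets of intervals and their counting functions -/

section Intervals

variable {α : Type*} [LinearOrder α]

open Classical in
-- If `I` were not in `m'`, maximality would give each `J ∈ m'` a point `p J` of `I` that it misses.
-- Some `J ∈ m'` must contain the least and the greatest of these finitely many points of `I`, since
-- `I` does; by convexity this `J` contains `p J`.
theorem mem_of_maximal_of_countP_eq {m m' : Multiset (Set α)}
    (hm' : ∀ I ∈ m', I.OrdConnected)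
    (h : ∀ r s, r ≤ s → m.countP (fun I => r ∈ I ∧ s ∈ I) = m'.countP (fun I => r ∈ I ∧ s ∈ I))
    {I : Set α} (hI : I ∈ m) (hne : I.Nonempty) (hmax : ∀ J ∈ m', I ⊆ J → I = J) : I ∈ m' := by
  by_contra hI'
  have hp : ∀ J ∈ m'.toFinset, ∃ p ∈ I, p ∉ J := by
    intro J hJ
    rw [Multiset.mem_toFinset] at hJ
    by_contra! hsub
    exact hI' (hmax J hJ hsub ▸ hJ)
  obtain ⟨x, hx⟩ := hne
  have : Nonempty α := ⟨x⟩
  choose! p hpI hpJ using hp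
  let F : Finset α := insert x (m'.toFinset.image p)
  have hF : F.Nonempty := Finset.insert_nonempty _ _
  have hFI : ∀ y ∈ F, y ∈ I := by
    intro y hy
    rcases Finset.mem_insert.1 hy with rfl | hy
    · exact hx
    · obtain ⟨J, hJ, rfl⟩ := Finset.mem_image.1 hy
      exact hpI J hJ
  have hpos : 0 < m.countP (fun I => F.min' hF ∈ I ∧ F.max' hF ∈ I) :=
    Multiset.countP_pos.2 ⟨I, hI, hFI _ (F.min'_mem hF), hFI _ (F.max'_mem hF)⟩
  rw [h _ _ (F.min'_le _ (F.max'_mem hF)), Multiset.countP_pos] at hpos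
  obtain ⟨J, hJ, h1, h2⟩ := hpos
  have hJ' := Multiset.mem_toFinset.2 hJ
  have hpF : p J ∈ F := Finset.mem_insert_of_mem (Finset.mem_image_of_mem p hJ')
  exact hpJ J hJ' ((hm' J hJ).out h1 h2 ⟨F.min'_le _ hpF, F.le_max' _ hpF⟩)

open Classical in
/-- A finite multiset of nonempty intervals is determined by the numbers of its members which
contain given pairs of points. -/
theorem multiset_eq_of_countP_eq (m m' : Multiset (Set α))
    (hm : ∀ I ∈ m, I.OrdConnected ∧ I.Nonempty) (hm' : ∀ I ∈ m', I.OrdConnected ∧ I.Nonempty)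
    (h : ∀ r s, r ≤ s → m.countP (fun I => r ∈ I ∧ s ∈ I) = m'.countP (fun I => r ∈ I ∧ s ∈ I)) :
    m = m' := by
  induction m using Multiset.strongInductionOn generalizing m' with
  | ih m ih =>
    by_cases h0 : (m + m').toFinset.Nonempty
    · obtain ⟨I, hI⟩ := (m + m').toFinset.exists_maximal h0
      have hI1 : I ∈ m ∨ I ∈ m' := by simpa using hI.1
      have hmax : ∀ J, J ∈ m ∨ J ∈ m' → I ⊆ J → I = J := fun J hJ hIJ =>
        hI.eq_of_le (by simpa using hJ) hIJ
      have hmm : I ∈ m ∧ I ∈ m' := by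
        rcases hI1 with h1 | h1
        · exact ⟨h1, mem_of_maximal_of_countP_eq (fun J hJ => (hm' J hJ).1) h h1 (hm I h1).2
            fun J hJ => hmax J (Or.inr hJ)⟩
        · exact ⟨mem_of_maximal_of_countP_eq (fun J hJ => (hm J hJ).1)
            (fun r s hrs => (h r s hrs).symm) h1 (hm' I h1).2 fun J hJ => hmax J (Or.inl hJ), h1⟩
      obtain ⟨n, rfl⟩ := Multiset.exists_cons_of_mem hmm.1
      obtain ⟨n', rfl⟩ := Multiset.exists_cons_of_mem hmm.2
      rw [ih n (Multiset.lt_cons_self n I) n' (fun J hJ => hm J (Multiset.mem_cons_of_mem hJ))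
        (fun J hJ => hm' J (Multiset.mem_cons_of_mem hJ))]
      intro r s hrs
      have := h r s hrs
      rw [Multiset.countP_cons, Multiset.countP_cons] at this
      exact Nat.add_right_cancel this
    · rw [Finset.not_nonempty_iff_eq_empty, Multiset.toFinset_eq_empty] at h0
      obtain ⟨rfl, rfl⟩ := add_eq_zero.1 h0
      rfl

end Intervals

section Uniqueness

variable {k : Type u} [Field k] {P : Set ℝ}

/-- Ranks of structure maps count the intervals containing two given parameters, and these counts
determine the intervals. Thus the choice made in `dgm` agrees with any explicit decomposition. -/
theorem IsDiagram.unique {M : PersistenceModule.{u, v} k P} {α β : Multiset (ℝ × ℝ)}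
    (hα : IsDiagram M α) (hβ : IsDiagram M β) : α = β := by
  classical
  obtain ⟨n, I, hI, hIne, e, he, rfl⟩ := hα
  obtain ⟨n', I', hI', hIne', e', he', rfl⟩ := hβ
  have key : (Finset.univ : Finset (Fin n)).val.map I = (Finset.univ : Finset (Fin n')).val.map I' := by
    refine multiset_eq_of_countP_eq _ _ ?_ ?_ ?_
    · intro J hJ
      obtain ⟨j, -, rfl⟩ := Multiset.mem_map.1 hJ
      exact ⟨hI j, hIne j⟩
    · intro J hJ
      obtain ⟨j, -, rfl⟩ := Multiset.mem_map.1 hJ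
      exact ⟨hI' j, hIne' j⟩
    · intro r s hrs
      have h1 := finrank_range_of_decomposition e he (homOfLE hrs)
      rw [finrank_range_of_decomposition e' he' (homOfLE hrs)] at h1
      rw [Multiset.countP_map, Multiset.countP_map]
      simpa [Nat.card_eq_fintype_card, Fintype.card_subtype, Finset.card_def] using h1.symm
  have := congrArg (Multiset.map fun J : Set P =>
    (sInf ((fun t : P => (t : ℝ)) '' J), sSup ((fun t : P => (t : ℝ)) '' J))) key
  simpa [Multiset.map_map, Function.comp_def] using this

theorem IsDiagram.dgm_eq {M : PersistenceModule.{u, v} k P} {α : Multiset (ℝ × ℝ)}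
    (hα : IsDiagram M α) : dgm M = α := by
  have h : ∃ α, IsDiagram M α := ⟨α, hα⟩
  rw [dgm, dif_pos h]
  exact h.choose_spec.unique hα

/-- A decomposition into interval modules indexed by any finite type yields a diagram. -/
theorem isDiagram_of_decomposition {M : PersistenceModule.{u, v} k P} {ι : Type*} [Fintype ι]
    (I : ι → Set P) [hI : ∀ j, (I j).OrdConnected] (hne : ∀ j, (I j).Nonempty)
    (e : ∀ t : P, M.obj t ≃ₗ[k] (∀ j, intervalSpace k (I j) t))
    (he : ∀ (s t : P) (f : s ⟶ t) (x : M.obj s) (j : ι),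
      e t ((M.map f).hom x) j = intervalMap k (I j) s t (e s x j)) :
    IsDiagram M (Finset.univ.val.map fun j =>
      (sInf ((fun t : P => (t : ℝ)) '' I j), sSup ((fun t : P => (t : ℝ)) '' I j))) := by
  let ε := (Fintype.equivFin ι).symm
  refine ⟨Fintype.card ι, fun j => I (ε j), fun j => hI _, fun j => hne _,
    fun t => (e t).trans (LinearEquiv.piCongrLeft k (fun j => intervalSpace k (I j) t) ε).symm,
    fun s t f x j => he s t f x (ε j), ?_⟩
  rw [← Finset.univ_map_equiv_to_embedding ε, Finset.map_val, Multiset.map_map]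
  rfl

end Uniqueness

/-! ### Pairing of births and deaths -/

section Pairing

variable {k : Type*} [Field k] {Q : Type*} [LinearOrder Q] {V : Type*} [AddCommGroup V] [Module k V]

/-- `Z` and `R` behave like the cycles and the bounding cycles, in a fixed degree, of a complex with
the set `Q` of cells, when these are added one at a time. -/
structure IsCellwise (Z R : Set Q → Submodule k V) : Prop where
  Z_empty : Z ∅ = ⊥
  R_le : ∀ S, R S ≤ Z S
  Z_mono : Monotone Z
  R_mono : Monotone R
  step_Z : ∀ p, ∀ x ∈ Z (Set.Iic p), x ∉ Z (Set.Iio p) → ∀ y ∈ Z (Set.Iic p),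
    ∃ c : k, y - c • x ∈ Z (Set.Iio p)
  -- In degree `n`, the first alternative is a cell of dimension other than `n + 1`, which adds no
  -- boundaries. The second is an `(n + 1)`-cell, which adds no `n`-cycles and at most one dimension
  -- of boundaries.
  step_R : ∀ q, R (Set.Iic q) ⊓ Z (Set.Iio q) ≤ R (Set.Iio q) ∨
    (Z (Set.Iic q) ≤ Z (Set.Iio q) ∧ ∀ x ∈ R (Set.Iic q), x ∉ R (Set.Iio q) →
      ∀ y ∈ R (Set.Iic q), ∃ c : k, y - c • x ∈ R (Set.Iio q))

/-- The births (elements of `births`), with the time `death` of their deaths, together with cycles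
`vec` which represent the classes that are born, and coefficient functionals `coord`. -/
structure Pairing (Z R : Set Q → Submodule k V) where
  births : Set Q
  death : Q → WithTop Q
  vec : Q → V
  coord : Q → V →ₗ[k] k
  coord_vec : ∀ p p', p' ∈ births → coord p (vec p') = if p = p' then 1 else 0
  vec_mem : ∀ p ∈ births, vec p ∈ Z (Set.Iic p)
  vec_notMem : ∀ p ∈ births, vec p ∉ Z (Set.Iio p)
  vec_mem_R : ∀ p ∈ births, ∀ q : Q, death p = q → vec p ∈ R (Set.Iic q)
  -- The last three fields say that one basis is adapted to `Z S` and `R S` for all lower sets `S`: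
  -- `Z S` involves only births in `S`, and inside it `R S` is cut out by the coordinates of the
  -- classes not yet dead.
  coord_Z : ∀ S, IsLowerSet S → ∀ x ∈ Z S, ∀ p, p ∉ S → coord p x = 0
  coord_R : ∀ S, IsLowerSet S → ∀ x ∈ R S, ∀ p, (∀ q ∈ S, death p ≠ q) → coord p x = 0
  mem_R : ∀ S, IsLowerSet S → ∀ x ∈ Z S,
    (∀ p ∈ births, p ∈ S → (∀ q ∈ S, death p ≠ q) → coord p x = 0) → x ∈ R S

variable {Z R : Set Q → Submodule k V}

open Classical in
-- Gaussian elimination from the top cell down: an element that is new at `p` loses its leading part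
-- by subtracting a multiple of `vec p`, and stays in `W` because `vec p ∈ W`. It is applied with `W
-- = ⊤` and with `W = R S`.
theorem inf_le_span_of_adapted [Finite Q] (h : IsCellwise Z R) {births : Set Q}
    (hZ : ∀ p ∉ births, Z (Set.Iic p) ≤ Z (Set.Iio p)) {vec : Q → V}
    (hvec : ∀ p ∈ births, vec p ∈ Z (Set.Iic p) ∧ vec p ∉ Z (Set.Iio p)) (W : Submodule k V)
    (D : Set Q) (hD : ∀ p ∈ births, W ⊓ Z (Set.Iic p) ≤ Z (Set.Iio p) ∨ vec p ∈ W ∧ p ∈ D)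
    {S : Set Q} (hS : IsLowerSet S) :
    W ⊓ Z S ≤ Submodule.span k (vec '' (births ∩ D ∩ S)) := by
  obtain ⟨s, rfl⟩ := S.toFinite.exists_finset_coe
  induction s using Finset.induction_on_max with
  | empty =>
    rw [Finset.coe_empty, h.Z_empty, inf_bot_eq]
    exact bot_le
  | insert p s hp ih =>
    have hlt : (s : Set Q) = Set.Iio p := by
      ext q
      refine ⟨fun hq => hp q hq, fun hq => ?_⟩
      have := hS (le_of_lt hq) (Finset.mem_coe.2 (Finset.mem_insert_self p s))
      rcases Finset.mem_insert.1 (Finset.mem_coe.1 this) with rfl | h1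
      · exact absurd hq (lt_irrefl _)
      · exact h1
    have hle : ((insert p s : Finset Q) : Set Q) = Set.Iic p := by
      rw [Finset.coe_insert, hlt, Set.Iio_insert]
    have ih' := ih (hlt ▸ isLowerSet_Iio p)
    have hmono : Submodule.span k (vec '' (births ∩ D ∩ (s : Set Q))) ≤
        Submodule.span k (vec '' (births ∩ D ∩ Set.Iic p)) := by
      rw [hlt]
      exact Submodule.span_mono (Set.image_mono
        (Set.inter_subset_inter_right _ Set.Iio_subset_Iic_self))
    rw [hle]
    rw [hlt] at ih' hmono
    rintro x ⟨hxW, hx⟩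
    by_cases hx' : x ∈ Z (Set.Iio p)
    · exact hmono (ih' ⟨hxW, hx'⟩)
    · have hpb : p ∈ births := by
        by_contra hpb
        exact hx' (hZ p hpb hx)
      obtain ⟨h1, h2⟩ := hvec p hpb
      rcases hD p hpb with h3 | ⟨h3, h4⟩
      · exact absurd (h3 ⟨hxW, hx⟩) hx'
      · obtain ⟨c, hc⟩ := h.step_Z p _ h1 h2 x hx
        have h5 := hmono (ih' ⟨W.sub_mem hxW (W.smul_mem c h3), hc⟩)
        have h6 : vec p ∈ Submodule.span k (vec '' (births ∩ D ∩ Set.Iic p)) :=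
          Submodule.subset_span ⟨p, ⟨⟨hpb, h4⟩, le_rfl⟩, rfl⟩
        simpa using Submodule.add_mem _ h5 (Submodule.smul_mem _ c h6)

/-- The family is triangular: the vectors of earlier births lie in `Z (Set.Iio p)`, and `vec p` does
not. -/
theorem linearIndepOn_of_notMem [Finite Q] (h : IsCellwise Z R) {births : Set Q} {vec : Q → V}
    (hvec : ∀ p ∈ births, vec p ∈ Z (Set.Iic p) ∧ vec p ∉ Z (Set.Iio p)) :
    LinearIndepOn k vec births := by
  classical
  obtain ⟨s, rfl⟩ := births.toFinite.exists_finset_coe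
  induction s using Finset.induction_on_max with
  | empty => rw [Finset.coe_empty]; exact linearIndepOn_empty k vec
  | insert p s hp ih =>
    rw [Finset.coe_insert] at hvec ⊢
    refine (ih fun q hq => hvec q (Set.mem_insert_of_mem _ hq)).insert fun hm => ?_
    refine (hvec p (Set.mem_insert _ _)).2 (Submodule.span_le.2 ?_ hm)
    rintro _ ⟨q, hq, rfl⟩
    exact h.Z_mono (Set.Iic_subset_Iio.2 (hp q hq)) (hvec q (Set.mem_insert_of_mem _ hq)).1

open Classical in
theorem exists_coord {births : Set Q} {vec : Q → V} (hli : LinearIndepOn k vec births) :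
    ∃ coord : Q → V →ₗ[k] k, (∀ p p', p' ∈ births → coord p (vec p') = if p = p' then 1 else 0) := by
  obtain ⟨g, hg⟩ := LinearMap.exists_leftInverse_of_injective
    (Finsupp.linearCombination k fun p : births => vec p) (LinearMap.ker_eq_bot.2 hli)
  refine ⟨fun p => if hp : p ∈ births then Finsupp.lapply ⟨p, hp⟩ ∘ₗ g else 0, fun p p' hp' => ?_⟩
  have h1 : g (vec p') = Finsupp.single ⟨p', hp'⟩ 1 := by
    simpa using LinearMap.congr_fun hg (Finsupp.single ⟨p', hp'⟩ 1)
  by_cases hp : p ∈ births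
  · simp [hp, h1, Finsupp.single_apply, eq_comm]
  · have : p ≠ p' := fun h => hp (h ▸ hp')
    simp [hp, this]

/-- The death of `p` is the first `q` at which some cycle with leading cell `p` bounds. Choosing the
representative among those bounding cycles makes it serve both the birth and the death. -/
theorem exists_first_death [Finite Q] (Z R : Set Q → Submodule k V) (p : Q)
    (hp : ¬ Z (Set.Iic p) ≤ Z (Set.Iio p)) : ∃ (d : WithTop Q) (x : V),
      x ∈ Z (Set.Iic p) ∧ x ∉ Z (Set.Iio p) ∧ (∀ q : Q, d = q → x ∈ R (Set.Iic q)) ∧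
      ∀ q : Q, q < d → R (Set.Iic q) ⊓ Z (Set.Iic p) ≤ Z (Set.Iio p) := by
  by_cases hd : ∃ q, ¬ R (Set.Iic q) ⊓ Z (Set.Iic p) ≤ Z (Set.Iio p)
  · obtain ⟨q, hq⟩ := Set.Finite.exists_minimal
      (s := {q | ¬ R (Set.Iic q) ⊓ Z (Set.Iic p) ≤ Z (Set.Iio p)}) (Set.toFinite _) hd
    obtain ⟨x, hx, hx'⟩ := SetLike.not_le_iff_exists.1 hq.1
    refine ⟨q, x, hx.2, hx', fun q' h => ?_, fun q' hq' => ?_⟩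
    · rw [← WithTop.coe_inj.1 h]
      exact hx.1
    · by_contra h
      exact not_le_of_gt (WithTop.coe_lt_coe.1 hq') (hq.2 h (le_of_lt (WithTop.coe_lt_coe.1 hq')))
  · push Not at hd
    obtain ⟨x, hx, hx'⟩ := SetLike.not_le_iff_exists.1 hp
    exact ⟨⊤, x, hx, hx', fun q h => absurd h (WithTop.coe_ne_top).symm, fun q _ => hd q⟩

theorem IsLowerSet.eq_empty_or_Iic [Finite Q] {S : Set Q} (hS : IsLowerSet S) :
    S = ∅ ∨ ∃ q, S = Set.Iic q := by
  rcases S.eq_empty_or_nonempty with h | h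
  · exact Or.inl h
  · obtain ⟨q, hq⟩ := S.toFinite.exists_maximal h
    refine Or.inr ⟨q, Set.ext fun r => ⟨fun hr => ?_, fun hr => hS hr hq.1⟩⟩
    rcases le_total r q with h1 | h1
    · exact h1
    · exact hq.2 hr h1

theorem IsCellwise.nonempty_pairing [Finite Q] (h : IsCellwise Z R) : Nonempty (Pairing Z R) := by
  classical
  have := Fintype.ofFinite Q
  choose! death vec hvZ hvZ' hvR hd using fun p => exists_first_death Z R p
  let births : Set Q := {p | ¬ Z (Set.Iic p) ≤ Z (Set.Iio p)}
  have hvec : ∀ p ∈ births, vec p ∈ Z (Set.Iic p) ∧ vec p ∉ Z (Set.Iio p) :=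
    fun p hp => ⟨hvZ p hp, hvZ' p hp⟩
  obtain ⟨coord, hc⟩ := exists_coord (linearIndepOn_of_notMem h hvec)
  have hbirths : ∀ p ∉ births, Z (Set.Iic p) ≤ Z (Set.Iio p) := fun p hp => not_not.1 hp
  have hspanZ : ∀ S, IsLowerSet S → Z S ≤ Submodule.span k (vec '' (births ∩ Set.univ ∩ S)) := by
    intro S hS
    have := inf_le_span_of_adapted h hbirths hvec ⊤ Set.univ
      (fun p _ => Or.inr ⟨Submodule.mem_top, Set.mem_univ p⟩) hS
    rwa [top_inf_eq] at this
  have hspanR : ∀ S, IsLowerSet S →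
      R S ≤ Submodule.span k (vec '' (births ∩ {p | ∃ q ∈ S, death p = q} ∩ S)) := by
    intro S hS
    have := inf_le_span_of_adapted h hbirths hvec (R S) {p | ∃ q ∈ S, death p = q} ?_ hS
    · rwa [inf_eq_left.2 (h.R_le S)] at this
    · intro p hp
      rcases IsLowerSet.eq_empty_or_Iic hS with rfl | ⟨q, rfl⟩
      · refine Or.inl (inf_le_left.trans ((h.R_le _).trans ?_))
        rw [h.Z_empty]
        exact bot_le
      -- Before the death, minimality excludes bounding cycles with leading cell `p`; from the death
      -- on, `vec p` is itself one.
      · rcases lt_or_ge (q : WithTop Q) (death p) with h1 | h1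
        · exact Or.inl (hd p hp q h1)
        · obtain ⟨q', hq', h2⟩ := WithTop.le_coe_iff.1 h1
          exact Or.inr ⟨h.R_mono (Set.Iic_subset_Iic.2 h2) (hvR p hp q' hq'), q', h2, hq'⟩
  have hzero : ∀ (T : Set Q) (x : V), T ⊆ births → x ∈ Submodule.span k (vec '' T) →
      ∀ p ∉ T, coord p x = 0 := by
    intro T x hT hx p hp
    have : Submodule.span k (vec '' T) ≤ LinearMap.ker (coord p) := by
      rw [Submodule.span_le]
      rintro _ ⟨p', hp', rfl⟩
      have hne : p ≠ p' := fun h => hp (h ▸ hp')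
      rw [SetLike.mem_coe, LinearMap.mem_ker, hc p p' (hT hp'), if_neg hne]
    exact this hx
  -- The sum may run over all of `Q`: outside `births` the vector `vec p` is arbitrary, but `coord
  -- p` vanishes on the span.
  have hsum : ∀ x ∈ Submodule.span k (vec '' births), x = ∑ p, coord p x • vec p := by
    intro x hx
    have : Submodule.span k (vec '' births) ≤
        LinearMap.eqLocus LinearMap.id (∑ p, (coord p).smulRight (vec p)) := by
      rw [Submodule.span_le]
      rintro _ ⟨p', hp', rfl⟩
      simp [hc _ p' hp']
    simpa using this hx
  refine ⟨⟨births, death, vec, coord, hc, hvZ, hvZ', hvR, ?_, ?_, ?_⟩⟩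
  · exact fun S hS x hx p hp => hzero _ x (fun _ h => h.1.1) (hspanZ S hS hx) p fun h => hp h.2
  · exact fun S hS x hx p hp => hzero _ x (fun _ h => h.1.1) (hspanR S hS hx) p
      fun ⟨⟨_, q, hq, h⟩, _⟩ => hp q hq h
  · intro S hS x hx hx'
    have hx1 := hspanZ S hS hx
    rw [hsum x (Submodule.span_mono (Set.image_mono fun _ h => h.1.1) hx1)]
    refine Submodule.sum_mem _ fun p _ => ?_
    by_cases hp : p ∈ births ∩ Set.univ ∩ S
    · by_cases hq : ∃ q ∈ S, death p = q
      · obtain ⟨q, hq, hpq⟩ := hq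
        exact Submodule.smul_mem _ _ (h.R_mono (hS.Iic_subset hq) (hvR p hp.1.1 q hpq))
      · push Not at hq
        rw [hx' p hp.1.1 hp.2 hq, zero_smul]
        exact Submodule.zero_mem _
    · rw [hzero _ x (fun _ h => h.1.1) hx1 p hp, zero_smul]
      exact Submodule.zero_mem _

namespace Pairing

variable (π : Pairing Z R)

theorem vec_notMem_R {p : Q} (hp : p ∈ π.births) {S : Set Q} (hS : IsLowerSet S)
    (h : ∀ q ∈ S, π.death p ≠ q) : π.vec p ∉ R S := by
  intro hm
  have := π.coord_R S hS _ hm p h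
  rw [π.coord_vec p p hp, if_pos rfl] at this
  exact one_ne_zero this

theorem vec_notMem_R_Iio {p q : Q} (hp : p ∈ π.births) (h : π.death p = q) :
    π.vec p ∉ R (Set.Iio q) :=
  π.vec_notMem_R hp (isLowerSet_Iio q) fun _ hr hr' =>
    (ne_of_lt hr) (WithTop.coe_inj.1 (hr'.symm.trans h))

theorem vec_mem_Iio (h : IsCellwise Z R) {p q : Q} (hp : p ∈ π.births) (hpq : p < q) :
    π.vec p ∈ Z (Set.Iio q) :=
  h.Z_mono (Set.Iic_subset_Iio.2 hpq) (π.vec_mem p hp)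

/-- A cell that kills a class does not create one. -/
theorem notMem_births (h : IsCellwise Z R) {p q : Q} (hp : p ∈ π.births) (hpq : p < q)
    (hq : π.death p = q) : q ∉ π.births := by
  rcases h.step_R q with h1 | ⟨h1, -⟩
  · exact absurd (h1 ⟨π.vec_mem_R p hp q hq, π.vec_mem_Iio h hp hpq⟩) (π.vec_notMem_R_Iio hp hq)
  · exact fun hqb => π.vec_notMem q hqb (h1 (π.vec_mem q hqb))

/-- As `R` grows by at most one dimension at `q`, some `vec p' - c • vec p` already bounds before
`q`. If `p ≠ p'`, its coordinate at `p'` is `1`, whereas classes dying at `q` have coordinate `0` on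
`R (Set.Iio q)`. The condition `p < q` excludes the first alternative of `step_R`. -/
theorem death_injective (h : IsCellwise Z R) {p p' q : Q} (hp : p ∈ π.births)
    (hp' : p' ∈ π.births) (hpq : p < q) (hq : π.death p = q) (hq' : π.death p' = q) : p = p' := by
  rcases h.step_R q with h1 | ⟨-, h1⟩
  · exact absurd (h1 ⟨π.vec_mem_R p hp q hq, π.vec_mem_Iio h hp hpq⟩) (π.vec_notMem_R_Iio hp hq)
  · by_contra hne
    obtain ⟨c, hc⟩ := h1 _ (π.vec_mem_R p hp q hq) (π.vec_notMem_R_Iio hp hq) _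
      (π.vec_mem_R p' hp' q hq')
    have := π.coord_R _ (isLowerSet_Iio q) _ hc p' fun r hr hr' =>
      (ne_of_lt hr) (WithTop.coe_inj.1 (hr'.symm.trans hq'))
    rw [map_sub, map_smul, π.coord_vec _ _ hp, π.coord_vec _ _ hp', if_pos rfl,
      if_neg (Ne.symm hne)] at this
    simp at this

end Pairing

end Pairing

/-! ### Rank distances of interval modules -/

section Distance

variable (k : Type u) [Field k]

theorem rankInvariant_intervalModule {P : Set ℝ} (I : Set P) [I.OrdConnected] (x : ℝ × ℝ)
    {c : Prop} [Decidable c] (hc : c ↔ ∃ (h₁ : x.1 ∈ P) (h₂ : x.2 ∈ P),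
      x.1 ≤ x.2 ∧ (⟨x.1, h₁⟩ : P) ∈ I ∧ (⟨x.2, h₂⟩ : P) ∈ I) :
    rankInvariant (intervalModule k I) x = if c then 1 else 0 := by
  unfold rankInvariant
  by_cases h : ∃ (_ : x.1 ∈ P) (_ : x.2 ∈ P), x.1 ≤ x.2
  · rw [dif_pos h, finrank_range_of_decomposition (ι := Unit) (I := fun _ => I)
      (fun t => (LinearEquiv.funUnique Unit k ((intervalModule k I).obj t)).symm)
      (fun _ _ _ _ _ => rfl)]
    obtain ⟨h₁, h₂, h₃⟩ := h
    by_cases hI : (⟨x.1, h₁⟩ : P) ∈ I ∧ (⟨x.2, h₂⟩ : P) ∈ I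
    · rw [if_pos (hc.2 ⟨h₁, h₂, h₃, hI⟩)]
      simp [hI.1, hI.2]
    · rw [if_neg fun h => hI (hc.1 h).2.2.2]
      simp [hI]
  · rw [dif_neg h, if_neg fun h' => h ⟨(hc.1 h').1, (hc.1 h').2.1, (hc.1 h').2.2.1⟩]

variable {a b : ℝ}

open Classical in
theorem rankInvariant_pointInterval {x₁ x₂ : ℝ} (h₁ : a ≤ x₁) (h₂ : x₂ ≤ 2 * b - a) (p : ℝ × ℝ) :
    rankInvariant (intervalModule k (pointInterval (paramRange a b) (some (x₁, x₂)))) p =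
      if x₁ ≤ p.1 ∧ p.1 ≤ p.2 ∧ p.2 ≤ x₂ then 1 else 0 := by
  refine rankInvariant_intervalModule k _ p ⟨?_, ?_⟩
  · rintro ⟨h₃, h₄, h₅⟩
    exact ⟨⟨by linarith, by linarith⟩, ⟨by linarith, by linarith⟩, h₄, ⟨h₃, h₄.trans h₅⟩,
      ⟨h₃.trans h₄, h₅⟩⟩
  · rintro ⟨_, _, h, h₃, h₄⟩
    exact ⟨h₃.1, h, h₄.2⟩

theorem freeInterval_eq_pointInterval (a b x : ℝ) :
    freeInterval (paramRange a b) x = pointInterval (paramRange a b) (some (x, 2 * b - a)) :=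
  Set.ext fun t => ⟨fun h => ⟨h, t.2.2⟩, fun h => h.1⟩

open Classical in
theorem rankInvariant_freeInterval {x : ℝ} (h : a ≤ x) (p : ℝ × ℝ) :
    rankInvariant (intervalModule k (freeInterval (paramRange a b) x)) p =
      if x ≤ p.1 ∧ p.1 ≤ p.2 ∧ p.2 ≤ 2 * b - a then 1 else 0 := by
  rw [← rankInvariant_pointInterval k h le_rfl]
  congr 2
  simp only [freeInterval_eq_pointInterval]

theorem dRk_pointInterval_top {x y : ℝ} (hx : a ≤ x) (hy : a ≤ y) :
    dRk (intervalModule k (pointInterval (paramRange a b) (some (x, 2 * b - a))))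
      (intervalModule k (pointInterval (paramRange a b) (some (y, 2 * b - a)))) =
      dRkFree k (paramRange a b) x y := by
  simp only [dRkFree, dRk, rankInvariant_freeInterval k hx, rankInvariant_freeInterval k hy,
    rankInvariant_pointInterval k hx le_rfl, rankInvariant_pointInterval k hy le_rfl]

/-- The region between two free intervals. -/
def freeStrip (a b x y : ℝ) : Set (ℝ × ℝ) :=
  {p | min x y ≤ p.1 ∧ p.1 < max x y ∧ p.1 ≤ p.2 ∧ p.2 ≤ 2 * b - a}

/-- The region over `[a, ∞)` between the horizontal lines at height `x` and `y`. -/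
def heightStrip (a x y : ℝ) : Set (ℝ × ℝ) :=
  {p | min x y < p.2 ∧ p.2 ≤ max x y ∧ a ≤ p.1 ∧ p.1 ≤ p.2}

theorem measurableSet_freeStrip (a b x y : ℝ) : MeasurableSet (freeStrip a b x y) :=
  (measurableSet_le measurable_const measurable_fst).inter
    ((measurableSet_lt measurable_fst measurable_const).inter
      ((measurableSet_le measurable_fst measurable_snd).inter
        (measurableSet_le measurable_snd measurable_const)))

theorem measurableSet_heightStrip (a x y : ℝ) : MeasurableSet (heightStrip a x y) :=
  (measurableSet_lt measurable_const measurable_snd).inter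
    ((measurableSet_le measurable_snd measurable_const).inter
      ((measurableSet_le measurable_const measurable_fst).inter
        (measurableSet_le measurable_fst measurable_snd)))

/-- Slices at the same `s` are compared: the horizontal slice at height `s` lies in `[a, s]`, and
the vertical slice over `s` is `[s, 2b - a]`. The first is no longer than the second exactly when `s
≤ b`, which is the reason for the end point `2b - a`. -/
theorem volume_heightStrip_le {x y : ℝ} (hx : x ≤ b) (hy : y ≤ b) :
    volume (heightStrip a x y) ≤ volume (freeStrip a b x y) := by
  rw [Measure.volume_eq_prod, Measure.prod_apply_symm (measurableSet_heightStrip a x y),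
    Measure.prod_apply (measurableSet_freeStrip a b x y)]
  -- The strips are half-open at opposite ends, so the value `max x y` is discarded as a null set.
  have hae : ∀ᵐ s : ℝ, s ≠ max x y := by
    rw [ae_iff]
    simp
  refine lintegral_mono_ae (hae.mono fun s hs => ?_)
  by_cases h : min x y < s ∧ s ≤ max x y
  · calc volume ((fun r => (r, s)) ⁻¹' heightStrip a x y) ≤ volume (Set.Icc a s) :=
          measure_mono fun r hr => ⟨hr.2.2.1, hr.2.2.2⟩
      _ ≤ volume (Set.Icc s (2 * b - a)) := by
          rw [Real.volume_Icc, Real.volume_Icc]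
          have := h.2.trans (max_le hx hy)
          exact ENNReal.ofReal_le_ofReal (by linarith)
      _ ≤ volume (Prod.mk s ⁻¹' freeStrip a b x y) :=
          measure_mono fun r hr => ⟨h.1.le, lt_of_le_of_ne h.2 hs, hr.1, hr.2⟩
  · have : (fun r => (r, s)) ⁻¹' heightStrip a x y = ∅ :=
      Set.eq_empty_of_forall_notMem fun r hr => h ⟨hr.1, hr.2.1⟩
    rw [this, measure_empty]
    exact zero_le

/-- On the strip exactly one of the two free intervals has rank `1`. -/
theorem volume_freeStrip_le {x y : ℝ} (hx : a ≤ x) (hy : a ≤ y) :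
    volume (freeStrip a b x y) ≤ dRkFree k (paramRange a b) x y := by
  rw [← lintegral_indicator_one (measurableSet_freeStrip a b x y), dRkFree, dRk]
  refine lintegral_mono fun p => ?_
  rw [rankInvariant_freeInterval k hx, rankInvariant_freeInterval k hy]
  by_cases hp : p ∈ freeStrip a b x y
  · rw [Set.indicator_of_mem hp]
    obtain ⟨h₁, h₂, h₃, h₄⟩ := hp
    rcases le_total x y with h | h
    · rw [min_eq_left h] at h₁
      rw [max_eq_right h] at h₂
      rw [if_pos ⟨h₁, h₃, h₄⟩, if_neg fun h' => not_lt_of_ge h'.1 h₂]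
      simp
    · rw [min_eq_right h] at h₁
      rw [max_eq_left h] at h₂
      rw [if_pos (c := y ≤ p.1 ∧ _) ⟨h₁, h₃, h₄⟩, if_neg fun h' => not_lt_of_ge h'.1 h₂]
      simp
  · rw [Set.indicator_of_notMem hp]
    exact zero_le

theorem freeStrip_comm (a b x y : ℝ) : freeStrip a b x y = freeStrip a b y x := by
  simp only [freeStrip, min_comm, max_comm]

theorem heightStrip_comm (a x y : ℝ) : heightStrip a x y = heightStrip a y x := by
  simp only [heightStrip, min_comm, max_comm]

/-- A point of the first triangle leaves the second either to the left of `y₁` or above `y₂`. Both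
escapes are strict inequalities, whence the half-open strips. -/
theorem mem_freeStrip_or_heightStrip {x₁ x₂ y₁ y₂ : ℝ} (hx₁ : a ≤ x₁) (hx₂ : x₂ ≤ 2 * b - a)
    {p : ℝ × ℝ} (hx : x₁ ≤ p.1 ∧ p.1 ≤ p.2 ∧ p.2 ≤ x₂)
    (hy : ¬ (y₁ ≤ p.1 ∧ p.1 ≤ p.2 ∧ p.2 ≤ y₂)) :
    p ∈ freeStrip a b x₁ y₁ ∨ p ∈ heightStrip a x₂ y₂ := by
  obtain ⟨h₁, h₂, h₃⟩ := hx
  rcases lt_or_ge p.1 y₁ with h | h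
  · exact Or.inl ⟨(min_le_left _ _).trans h₁, lt_max_of_lt_right h, h₂, h₃.trans hx₂⟩
  · refine Or.inr ⟨min_lt_of_right_lt ?_, le_max_of_le_left h₃, hx₁.trans h₁, h₂⟩
    by_contra h'
    exact hy ⟨h, h₂, not_lt.1 h'⟩

open Classical in
/-- The distance of two interval modules is bounded by the distances of the free interval modules
on their end points. -/
theorem dRk_pointInterval_le {x₁ x₂ y₁ y₂ : ℝ} (hx₁ : a ≤ x₁) (hy₁ : a ≤ y₁) (hx₂ : x₂ ∈ Set.Icc a b)
    (hy₂ : y₂ ∈ Set.Icc a b) :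
    dRk (intervalModule k (pointInterval (paramRange a b) (some (x₁, x₂))))
      (intervalModule k (pointInterval (paramRange a b) (some (y₁, y₂)))) ≤
      dRkFree k (paramRange a b) x₁ y₁ + dRkFree k (paramRange a b) x₂ y₂ := by
  have hab : a ≤ b := hx₂.1.trans hx₂.2
  calc _ ≤ ∫⁻ p : ℝ × ℝ, (freeStrip a b x₁ y₁).indicator 1 p + (heightStrip a x₂ y₂).indicator 1 p := by
        refine lintegral_mono fun p => ?_
        rw [rankInvariant_pointInterval k hx₁ (by linarith [hx₂.2]),
          rankInvariant_pointInterval k hy₁ (by linarith [hy₂.2])]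
        have key : p ∈ freeStrip a b x₁ y₁ ∨ p ∈ heightStrip a x₂ y₂ → (1 : ℝ≥0∞) ≤
            (freeStrip a b x₁ y₁).indicator 1 p + (heightStrip a x₂ y₂).indicator 1 p := by
          rintro (h | h)
          · rw [Set.indicator_of_mem h]
            exact le_self_add
          · rw [Set.indicator_of_mem h]
            exact le_add_self
        by_cases hx : x₁ ≤ p.1 ∧ p.1 ≤ p.2 ∧ p.2 ≤ x₂ <;>
          by_cases hy : y₁ ≤ p.1 ∧ p.1 ≤ p.2 ∧ p.2 ≤ y₂
        · simp [hx, hy]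
        · rw [if_pos hx, if_neg hy]
          simpa using key (mem_freeStrip_or_heightStrip hx₁ (by linarith [hx₂.2]) hx hy)
        · rw [if_neg hx, if_pos hy]
          rw [freeStrip_comm a b x₁ y₁, heightStrip_comm a x₂ y₂] at key ⊢
          simpa using key (mem_freeStrip_or_heightStrip hy₁ (by linarith [hy₂.2]) hy hx)
        · rw [if_neg hx, if_neg hy]
          simp
    _ = volume (freeStrip a b x₁ y₁) + volume (heightStrip a x₂ y₂) := by
        rw [lintegral_add_left ((measurable_one).indicator (measurableSet_freeStrip a b x₁ y₁)),
          lintegral_indicator_one (measurableSet_freeStrip a b x₁ y₁),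
          lintegral_indicator_one (measurableSet_heightStrip a x₂ y₂)]
    _ ≤ _ := add_le_add (volume_freeStrip_le k hx₁ hy₁)
        ((volume_heightStrip_le hx₂.2 hy₂.2).trans (volume_freeStrip_le k hx₂.1 hy₂.1))

end Distance

open Topology Topology.RelCWComplex

/-! ### Adding the cells of a complex one at a time -/

section Chains

variable {X : Type v} [TopologicalSpace X] {C : Set X} [CWComplex C] (k : Type u) [Field k]
  [LinearOrder (Cells C)]

theorem mem_chainsOn_Iio {p : Cells C} {n : ℕ} {x : Chains C k n} (hx : x ∈ chainsOn k (Set.Iic p) n)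
    (h : ∀ τ, p = ⟨n, τ⟩ → x τ = 0) : x ∈ chainsOn k (Set.Iio p) n := by
  rw [chainsOn, Finsupp.mem_supported] at hx ⊢
  intro σ hσ
  refine lt_of_le_of_ne (hx hσ) fun he => ?_
  exact Finsupp.mem_support_iff.1 hσ (h σ he.symm)

theorem chainsOn_Iic_le {p : Cells C} {n : ℕ} (h : p.1 ≠ n) :
    chainsOn k (Set.Iic p) n ≤ chainsOn k (Set.Iio p) n :=
  fun _ hx => mem_chainsOn_Iio k hx fun _ hτ => absurd (congrArg Sigma.fst hτ) h

/-- Being new at `τ` means `x τ ≠ 0`, so the coefficient of `τ` in `y` can be eliminated. -/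
theorem sub_smul_mem_chainsOn {n : ℕ} {τ : cell C n} {x y : Chains C k n}
    (hx : x ∈ chainsOn k (Set.Iic (⟨n, τ⟩ : Cells C)) n)
    (hx' : x ∉ chainsOn k (Set.Iio (⟨n, τ⟩ : Cells C)) n)
    (hy : y ∈ chainsOn k (Set.Iic (⟨n, τ⟩ : Cells C)) n) :
    y - (y τ / x τ) • x ∈ chainsOn k (Set.Iio (⟨n, τ⟩ : Cells C)) n := by
  have h0 : x τ ≠ 0 := by
    intro h0
    refine hx' (mem_chainsOn_Iio k hx fun τ' h => ?_)
    obtain rfl := eq_of_heq (Sigma.mk.inj_iff.1 h).2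
    exact h0
  refine mem_chainsOn_Iio k (Submodule.sub_mem _ hy (Submodule.smul_mem _ _ hx)) fun τ' h => ?_
  obtain rfl := eq_of_heq (Sigma.mk.inj_iff.1 h).2
  rw [Finsupp.sub_apply, Finsupp.smul_apply, smul_eq_mul, div_mul_cancel₀ _ h0, sub_self]

end Chains

section Cells

variable {X : Type v} [TopologicalSpace X] [T2Space X] {C : Set X} [CWComplex C]

/-- Distinct open cells are disjoint, and the frontier of a cell lies in the skeleton of smaller
dimension. -/
theorem IsFace.eq_or_dim_lt {σ τ : Cells C} (h : IsFace σ τ) : σ = τ ∨ σ.1 < τ.1 := by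
  obtain ⟨x, hσ, hτ⟩ := h
  rcases lt_or_ge σ.1 τ.1 with hd | hd
  · exact Or.inr hd
  · left
    rw [← cellFrontier_union_openCell_eq_closedCell] at hτ
    rcases hτ with hτ | hτ
    · exact absurd hτ (Set.disjoint_left.1 (disjoint_openCell_cellFrontier hd τ.2 σ.2) hσ)
    · by_contra hne
      exact Set.disjoint_left.1 (disjoint_openCell_of_ne (i := σ.2) (j := τ.2) hne) hσ hτ

variable [CWComplex.Finite C]

/-- The order is lexicographic in weight, dimension and an arbitrary enumeration. The weight can
only tie between a proper face and its cell, and then the dimension puts the face first. -/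
theorem exists_respects {a b : ℝ} {w v : Cells C → ℝ} (hw : IsWeight a b w)
    (hwv : Compatible w v) : ∃ L : LinearOrder (Cells C), Respects L w ∧ Respects L v := by
  have : _root_.Finite (Cells C) := RelCWComplex.finite_cells_of_finite
  obtain ⟨n, ⟨e⟩⟩ := Finite.exists_equiv_fin (Cells C)
  let f : Cells C → ℝ ×ₗ ℕ ×ₗ Fin n := fun σ => toLex (w σ, toLex (σ.1, e σ))
  have hf : Function.Injective f := fun σ τ h => by
    exact e.injective (congrArg (fun x => (ofLex (ofLex x).2).2) h)
  let L : LinearOrder (Cells C) := LinearOrder.lift' f hf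
  have hle : ∀ σ τ, L.le σ τ ↔ w σ < w τ ∨ w σ = w τ ∧ toLex (σ.1, e σ) ≤ toLex (τ.1, e τ) :=
    fun σ τ => Prod.Lex.toLex_le_toLex
  have hface : ∀ σ τ, IsFace σ τ → L.le σ τ := by
    intro σ τ h
    rcases h.eq_or_dim_lt with rfl | hd
    · exact L.le_refl σ
    · rw [hle]
      rcases (hw.2 σ τ h).lt_or_eq with h1 | h1
      · exact Or.inl h1
      · exact Or.inr ⟨h1, Prod.Lex.toLex_le_toLex.2 (Or.inl hd)⟩
  have hmono : ∀ σ τ, L.le σ τ → w σ ≤ w τ := by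
    intro σ τ h
    rcases (hle σ τ).1 h with h1 | h1
    · exact h1.le
    · exact h1.1.le
  exact ⟨L, ⟨hface, hmono⟩, hface, fun σ τ h => (hwv σ τ).1 (hmono σ τ h)⟩

variable (k : Type u) [Field k]

variable (C) in
/-- The space of all cellular cycles. -/
def cycleSpace : (n : ℕ) → Submodule k (Chains C k n)
  | 0 => ⊤
  | n + 1 => LinearMap.ker (boundary C k n)

theorem cyclesOn_eq (S : Set (Cells C)) (n : ℕ) :
    cyclesOn k S n = chainsOn k S n ⊓ cycleSpace C k n := by
  cases n with
  | zero => exact (inf_top_eq _).symm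
  | succ n => rfl

/-- The cycles supported on `S` which bound on `S`. -/
def boundingCycles (S : Set (Cells C)) (n : ℕ) : Submodule k (Chains C k n) :=
  boundariesOn k S n ⊓ cyclesOn k S n

variable [L : LinearOrder (Cells C)]

theorem cyclesOn_Iic_le {p : Cells C} {n : ℕ} (h : p.1 ≠ n) :
    cyclesOn k (Set.Iic p) n ≤ cyclesOn k (Set.Iio p) n := by
  rw [cyclesOn_eq, cyclesOn_eq]
  exact inf_le_inf_right _ (chainsOn_Iic_le k h)

theorem boundariesOn_Iic_le {p : Cells C} {n : ℕ} (h : p.1 ≠ n + 1) :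
    boundariesOn k (Set.Iic p) n ≤ boundariesOn k (Set.Iio p) n :=
  Submodule.map_mono (chainsOn_Iic_le k h)

/-- A new cell enlarges the `n`-cycles only in dimension `n` and the `n`-boundaries only in
dimension `n + 1`, each by at most one dimension. Intersecting boundaries with cycles makes `R_le`
immediate and leaves the homology quotient unchanged. -/
theorem isCellwise (n : ℕ) :
    IsCellwise (fun S : Set (Cells C) => cyclesOn k S n) (fun S => boundingCycles k S n) where
  Z_empty := by
    rw [cyclesOn_eq, chainsOn]
    have : {σ : cell C n | (⟨n, σ⟩ : Cells C) ∈ (∅ : Set (Cells C))} = ∅ := rfl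
    rw [this, Finsupp.supported_empty, bot_inf_eq]
  R_le S := inf_le_right
  Z_mono S T h := cyclesOn_mono k h n
  R_mono S T h := inf_le_inf (Submodule.map_mono (chainsOn_mono k h (n + 1))) (cyclesOn_mono k h n)
  step_Z p x hx hx' y hy := by
    by_cases hp : p.1 = n
    · obtain ⟨m, τ⟩ := p
      obtain rfl : m = n := hp
      rw [cyclesOn_eq] at hx hx' hy ⊢
      refine ⟨y τ / x τ, sub_smul_mem_chainsOn k hx.1 (fun h => hx' ⟨h, hx.2⟩) hy.1,
        Submodule.sub_mem _ hy.2 (Submodule.smul_mem _ _ hx.2)⟩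
    · exact absurd (cyclesOn_Iic_le k hp hx) hx'
  step_R q := by
    by_cases hq : q.1 = n + 1
    · right
      have hZ := cyclesOn_Iic_le k (p := q) (n := n) (by lia)
      refine ⟨hZ, ?_⟩
      obtain ⟨m, τ⟩ := q
      obtain rfl : m = n + 1 := hq
      rintro _ ⟨⟨x, hx, rfl⟩, hxZ⟩ hx' _ ⟨⟨y, hy, rfl⟩, hyZ⟩
      refine ⟨y τ / x τ, ⟨y - (y τ / x τ) • x, sub_smul_mem_chainsOn k hx
        (fun h => hx' ⟨⟨x, h, rfl⟩, hZ hxZ⟩) hy, by simp⟩, ?_⟩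
      exact Submodule.sub_mem _ (hZ hyZ) (Submodule.smul_mem _ _ (hZ hxZ))
    · exact Or.inl fun x hx => ⟨boundariesOn_Iic_le k hq hx.1.1, hx.2⟩

theorem IsBirthCell.exists_notMem {i : ℕ} {σ : Cells C} (h : IsBirthCell k L i σ) :
    ∃ z ∈ cyclesOn k (Set.Iic σ) i, z ∉ cyclesOn k (Set.Iio σ) i := by
  by_contra! hall
  refine h fun y => ?_
  obtain ⟨z, rfl⟩ := Submodule.Quotient.mk_surjective _ y
  exact ⟨Submodule.Quotient.mk ⟨z.1, hall z.1 z.2⟩, rfl⟩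

theorem IsDeathCell.exists_notMem {i : ℕ} {σ : Cells C} (h : IsDeathCell k L i σ) :
    ∃ y ∈ boundariesOn k (Set.Iic σ) i, y ∉ boundariesOn k (Set.Iio σ) i := by
  by_contra! hall
  refine h ((injective_iff_map_eq_zero _).2 fun y hy => ?_)
  obtain ⟨z, rfl⟩ := Submodule.Quotient.mk_surjective _ y
  have hz := (Submodule.Quotient.mk_eq_zero
    ((boundariesOn k (Set.Iic σ) i).submoduleOf (cyclesOn k (Set.Iic σ) i))).1 hy
  exact (Submodule.Quotient.mk_eq_zero _).2 (hall z.1 hz)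

theorem IsBirthCell.dim_eq {i : ℕ} {σ : Cells C} (h : IsBirthCell k L i σ) : σ.1 = i := by
  by_contra hd
  obtain ⟨z, hz, hz'⟩ := h.exists_notMem
  exact hz' (cyclesOn_Iic_le k hd hz)

theorem IsDeathCell.dim_eq {i : ℕ} {σ : Cells C} (h : IsDeathCell k L i σ) : σ.1 = i + 1 := by
  by_contra hd
  obtain ⟨z, hz, hz'⟩ := h.exists_notMem
  exact hz' (boundariesOn_Iic_le k hd hz)

/-- A cycle `z` that is new at `σ` can be used to remove `σ` from any chain `u` without changing its
boundary, so `σ` adds no boundary. -/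
theorem IsBirthCell.not_isDeathCell {i : ℕ} {σ : Cells C} (h : IsBirthCell k L (i + 1) σ) :
    ¬ IsDeathCell k L i σ := by
  intro h'
  have hd := h.dim_eq
  obtain ⟨z, hz, hz'⟩ := h.exists_notMem
  obtain ⟨_, ⟨u, hu, rfl⟩, hy⟩ := h'.exists_notMem
  obtain ⟨m, τ⟩ := σ
  obtain rfl : m = i + 1 := hd
  refine hy ⟨_, sub_smul_mem_chainsOn k hz.1 (fun hm => hz' ⟨hm, hz.2⟩) hu, ?_⟩
  rw [map_sub, map_smul, LinearMap.mem_ker.1 hz.2, smul_zero, sub_zero]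

/-- Each cell is a birth or a death cell in at most one degree. -/
theorem degree_unique {i j : ℕ} {σ : Cells C} (hi : IsBirthCell k L i σ ∨ IsDeathCell k L i σ)
    (hj : IsBirthCell k L j σ ∨ IsDeathCell k L j σ) : i = j := by
  rcases hi with hi | hi <;> rcases hj with hj | hj
  · exact (hi.dim_eq).symm.trans hj.dim_eq
  · obtain rfl : i = j + 1 := (hi.dim_eq).symm.trans hj.dim_eq
    exact absurd hj (hi.not_isDeathCell)
  · obtain rfl : j = i + 1 := (hj.dim_eq).symm.trans hi.dim_eq
    exact absurd hi (hj.not_isDeathCell)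
  · exact Nat.succ_injective ((hi.dim_eq).symm.trans hj.dim_eq)

/-- The pairing of birth and death cells in degree `n`. -/
abbrev CellPairing (k : Type u) [Field k] (C : Set X) [CWComplex C] [CWComplex.Finite C]
    [LinearOrder (Cells C)] (n : ℕ) :=
  Pairing (fun S : Set (Cells C) => cyclesOn k S n) (fun S => boundingCycles k S n)

variable {k} {n : ℕ} (π : CellPairing k C n)

/-- Otherwise `vec p` would differ from an earlier cycle by a boundary on `Set.Iic p`. The
functional `coord p` kills that boundary, as `p` dies later, and kills the earlier cycle, but is `1`
on `vec p`. -/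
theorem isBirthCell_of_mem_births {p : Cells C} (hp : p ∈ π.births)
    (h : ∀ q : Cells C, π.death p = q → p < q) : IsBirthCell k L n p := by
  intro hs
  obtain ⟨y, hy⟩ := hs (Submodule.Quotient.mk ⟨π.vec p, π.vec_mem p hp⟩)
  obtain ⟨z, rfl⟩ := Submodule.Quotient.mk_surjective _ y
  have h1 : (z : Chains C k n) - π.vec p ∈ boundariesOn k (Set.Iic p) n :=
    (Submodule.Quotient.eq
      ((boundariesOn k (Set.Iic p) n).submoduleOf (cyclesOn k (Set.Iic p) n))).1 hy
  have h2 : (z : Chains C k n) - π.vec p ∈ boundingCycles k (Set.Iic p) n :=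
    ⟨h1, Submodule.sub_mem _ (cyclesOn_mono k (initial_subset L p) n z.2) (π.vec_mem p hp)⟩
  have h3 := π.coord_R _ (isLowerSet_Iic p) _ h2 p fun q hq hpq => not_lt_of_ge hq (h q hpq)
  rw [map_sub, π.coord_vec p p hp, if_pos rfl,
    π.coord_Z _ (isLowerSet_Iio p) _ z.2 p (lt_irrefl p)] at h3
  simp at h3

theorem isDeathCell_of_death_eq {p q : Cells C} (hp : p ∈ π.births) (hpq : p < q)
    (hq : π.death p = q) : IsDeathCell k L n q := by
  intro hi
  have hm := π.vec_mem_Iio (isCellwise k n) hp hpq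
  have h0 : homologyMap k (initial_subset L q) n (Submodule.Quotient.mk ⟨π.vec p, hm⟩) = 0 :=
    (Submodule.Quotient.mk_eq_zero _).2 (π.vec_mem_R p hp q hq).1
  have h1 := (injective_iff_map_eq_zero _).1 hi _ h0
  exact π.vec_notMem_R_Iio hp hq ⟨(Submodule.Quotient.mk_eq_zero
    ((boundariesOn k (Set.Iio q) n).submoduleOf (cyclesOn k (Set.Iio q) n))).1 h1, hm⟩

end Cells

/-! ### The persistence diagrams of a weight -/

section Diagram

/-- The life span, inside `P`, of a class which is born at `x` and dies at `d`. -/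
def lifeSpan (P : Set ℝ) (x : ℝ) (d : WithTop ℝ) : Set P := {t | x ≤ t ∧ ((t : ℝ) : WithTop ℝ) < d}

instance (P : Set ℝ) (x : ℝ) (d : WithTop ℝ) : (lifeSpan P x d).OrdConnected :=
  ⟨fun _ hr _ ht _ hs => ⟨hr.1.trans (Subtype.coe_le_coe.2 hs.1),
    (WithTop.coe_le_coe.2 (Subtype.coe_le_coe.2 hs.2)).trans_lt ht.2⟩⟩

variable {a b : ℝ}

/-- The point of the persistence diagram that represents a life span. -/
def lifePoint (a b x : ℝ) (d : WithTop ℝ) : ℝ × ℝ := (x, d.untopD (2 * b - a))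

/-- A class that never dies lives up to the end `2b - a` of the range. A finite death is at most
`b`, so the half-open life span lies entirely in the range and has the expected supremum. -/
theorem lifeSpan_endpoints {x : ℝ} {d : WithTop ℝ} (hx : x ∈ Set.Icc a b) (hxd : (x : WithTop ℝ) < d)
    (hd : ∀ y : ℝ, d = y → y ≤ b) :
    (lifeSpan (paramRange a b) x d).Nonempty ∧
    (sInf ((fun t : paramRange a b => (t : ℝ)) '' lifeSpan (paramRange a b) x d),
      sSup ((fun t : paramRange a b => (t : ℝ)) '' lifeSpan (paramRange a b) x d)) =
      lifePoint a b x d := by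
  obtain ⟨h₁, h₂⟩ := hx
  refine ⟨⟨⟨x, h₁, by linarith⟩, le_rfl, hxd⟩, ?_⟩
  induction d using WithTop.recTopCoe with
  | top =>
    have : (fun t : paramRange a b => (t : ℝ)) '' lifeSpan (paramRange a b) x ⊤ =
        Set.Icc x (2 * b - a) := by
      ext t
      constructor
      · rintro ⟨t, ht, rfl⟩
        exact ⟨ht.1, t.2.2⟩
      · exact fun ht => ⟨⟨t, h₁.trans ht.1, ht.2⟩, ⟨ht.1, WithTop.coe_lt_top t⟩, rfl⟩
    rw [this, csInf_Icc (by linarith), csSup_Icc (by linarith)]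
    rfl
  | coe y =>
    have hy := hd y rfl
    have hxy := WithTop.coe_lt_coe.1 hxd
    have : (fun t : paramRange a b => (t : ℝ)) '' lifeSpan (paramRange a b) x y = Set.Ico x y := by
      ext t
      constructor
      · rintro ⟨t, ht, rfl⟩
        exact ⟨ht.1, WithTop.coe_lt_coe.1 ht.2⟩
      · exact fun ht => ⟨⟨t, h₁.trans ht.1, by linarith [ht.2]⟩, ⟨ht.1, WithTop.coe_lt_coe.2 ht.2⟩,
          rfl⟩
    rw [this, csInf_Ico hxy, csSup_Ico hxy]
    rfl

variable {X : Type v} [TopologicalSpace X] {C : Set X} [CWComplex C]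

theorem isLowerSet_sublevel [LinearOrder (Cells C)] {w : Cells C → ℝ} (hw : Monotone w) (t : ℝ) :
    IsLowerSet (sublevel w t) :=
  fun _ _ h hp => (hw h).trans hp

variable [T2Space X] [CWComplex.Finite C] {k : Type u} [Field k] [LinearOrder (Cells C)] {n : ℕ}

/-- The birth cells of the classes that live for a positive time. -/
def bars (π : CellPairing k C n) (w : Cells C → ℝ) : Set (Cells C) :=
  {p | p ∈ π.births ∧ (w p : WithTop ℝ) < (π.death p).map w}

theorem mem_bars_iff (π : CellPairing k C n) (w : Cells C → ℝ) (p : Cells C) :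
    p ∈ bars π w ↔ p ∈ π.births ∧ ∀ q : Cells C, π.death p = q → w p < w q := by
  refine and_congr_right fun _ => ?_
  induction π.death p using WithTop.recTopCoe with
  | top => simp
  | coe q => simp

/-- Positive life is a strict inequality between the weights of two cells, on which compatible
weights agree. -/
theorem bars_eq_of_compatible (π : CellPairing k C n) {w v : Cells C → ℝ} (h : Compatible w v) :
    bars π w = bars π v := by
  ext p
  simp only [mem_bars_iff, ← not_le, h _ _]

variable (P : Set ℝ) (π : CellPairing k C n) (w : Cells C → ℝ)

open Classical in
/-- The coefficients of the classes that are alive at `t`. -/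
def aliveCoord (t : P) : cyclesOn k (sublevel w t) n →ₗ[k]
    ∀ j : bars π w, intervalSpace k (lifeSpan P (w j) ((π.death j).map w)) t :=
  LinearMap.pi fun j => LinearMap.codRestrict _
    (if t ∈ lifeSpan P (w j) ((π.death j).map w) then
      π.coord j ∘ₗ (cyclesOn k (sublevel w t) n).subtype else 0)
    fun x ht => by rw [if_neg ht, LinearMap.zero_apply]

theorem aliveCoord_of_mem {t : P} (x : cyclesOn k (sublevel w t) n) {j : bars π w}
    (h : t ∈ lifeSpan P (w j) ((π.death j).map w)) :
    (aliveCoord P π w t x j : k) = π.coord j x := by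
  simp [aliveCoord, h]

theorem aliveCoord_of_notMem {t : P} (x : cyclesOn k (sublevel w t) n) {j : bars π w}
    (h : t ∉ lifeSpan P (w j) ((π.death j).map w)) : (aliveCoord P π w t x j : k) = 0 :=
  (aliveCoord P π w t x j).2 h

variable {w}

theorem coe_lt_death_map_iff {t : ℝ} {p : Cells C} :
    (t : WithTop ℝ) < (π.death p).map w ↔ ∀ q ∈ sublevel w t, π.death p ≠ q := by
  induction π.death p using WithTop.recTopCoe with
  | top => simp
  | coe q =>
    simp only [WithTop.map_coe, WithTop.coe_lt_coe, ne_eq, WithTop.coe_inj]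
    exact ⟨fun h r hr hqr => not_le_of_gt h (hqr ▸ hr), fun h => not_le.1 fun hq => h q hq rfl⟩

theorem ker_aliveCoord (hw : Monotone w) (t : P) :
    LinearMap.ker (aliveCoord P π w t) =
      (boundariesOn k (sublevel w t) n).submoduleOf (cyclesOn k (sublevel w t) n) := by
  have hS := isLowerSet_sublevel hw t
  ext x
  rw [LinearMap.mem_ker, funext_iff]
  constructor
  · intro h
    refine (π.mem_R _ hS x x.2 fun p hp hpt hd => ?_).1
    have hpd := (coe_lt_death_map_iff π).2 hd
    -- A class alive at `t` has positive life, so omitting the pairs of zero length loses no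
    -- coordinate.
    have hj : p ∈ bars π w := ⟨hp, (WithTop.coe_le_coe.2 hpt).trans_lt hpd⟩
    rw [← aliveCoord_of_mem P π w x (j := ⟨p, hj⟩) ⟨hpt, hpd⟩, h]
    rfl
  · intro h j
    refine Subtype.ext ?_
    by_cases hj : t ∈ lifeSpan P (w j) ((π.death j).map w)
    · rw [aliveCoord_of_mem P π w x hj]
      exact π.coord_R _ hS x ⟨h, x.2⟩ j ((coe_lt_death_map_iff π).1 hj.2)
    · exact aliveCoord_of_notMem P π w x hj

theorem aliveCoord_surjective [Fintype (bars π w)] (hw : Monotone w) (t : P) :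
    Function.Surjective (aliveCoord P π w t) := by
  classical
  intro y
  -- The coefficient `y j` vanishes unless the class is alive at `t`, and then its representative is
  -- supported on the sublevel set.
  have hmem : ∀ j, (y j : k) • π.vec j ∈ cyclesOn k (sublevel w t) n := by
    intro j
    by_cases hj : t ∈ lifeSpan P (w j) ((π.death j).map w)
    · exact Submodule.smul_mem _ _ (cyclesOn_mono k
        ((isLowerSet_sublevel hw t).Iic_subset hj.1) n (π.vec_mem j j.2.1))
    · rw [(y j).2 hj, zero_smul]
      exact Submodule.zero_mem _
  refine ⟨⟨∑ j, (y j : k) • π.vec j, Submodule.sum_mem _ fun j _ => hmem j⟩,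
    funext fun j => Subtype.ext ?_⟩
  by_cases hj : t ∈ lifeSpan P (w j) ((π.death j).map w)
  · rw [aliveCoord_of_mem P π w _ hj, map_sum, Finset.sum_eq_single j]
    · rw [map_smul, π.coord_vec _ _ j.2.1, if_pos rfl, smul_eq_mul, mul_one]
    · intro i _ hij
      rw [map_smul, π.coord_vec _ _ i.2.1, if_neg fun h => hij (Subtype.ext h.symm), smul_zero]
    · exact fun h => absurd (Finset.mem_univ j) h
  · rw [aliveCoord_of_notMem P π w _ hj, (y j).2 hj]

theorem aliveCoord_naturality (hw : Monotone w) {s t : P} (hst : s ≤ t)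
    (x : cyclesOn k (sublevel w s) n) (j : bars π w) :
    aliveCoord P π w t (Submodule.inclusion (cyclesOn_mono k (sublevel_mono w hst) n) x) j =
      intervalMap k (lifeSpan P (w j) ((π.death j).map w)) s t (aliveCoord P π w s x j) := by
  refine Subtype.ext ?_
  by_cases ht : t ∈ lifeSpan P (w j) ((π.death j).map w)
  · rw [intervalMap_apply_of_mem ht, aliveCoord_of_mem P π w _ ht]
    by_cases hs : s ∈ lifeSpan P (w j) ((π.death j).map w)
    · rw [aliveCoord_of_mem P π w _ hs]
      rfl
    · rw [aliveCoord_of_notMem P π w _ hs]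
      -- As `s ≤ t` and the class is alive at `t`, it can be missing at `s` only because it is not
      -- yet born.
      refine π.coord_Z _ (isLowerSet_sublevel hw s) _ x.2 j fun hj => hs ⟨hj, ?_⟩
      exact (WithTop.coe_le_coe.2 (Subtype.coe_le_coe.2 hst)).trans_lt ht.2
  · rw [aliveCoord_of_notMem P π w _ ht]
    exact ((intervalMap k _ s t (aliveCoord P π w s x j)).2 ht).symm

/-- The persistence diagram of a weight consists of the life spans of the classes in a pairing of
birth and death cells. -/
theorem isDiagram_persistentHomology (hw : Monotone w) (hab : ∀ σ, w σ ∈ Set.Icc a b)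
    [Fintype (bars π w)] :
    IsDiagram (persistentHomology k (paramRange a b) w n)
      (Finset.univ.val.map fun j : bars π w => lifePoint a b (w j) ((π.death j).map w)) := by
  have hend := fun j : bars π w => lifeSpan_endpoints (d := (π.death j).map w) (hab j) j.2.2
    fun y hy => by
      obtain ⟨q, -, rfl⟩ := WithTop.map_eq_some_iff.1 hy
      exact (hab q).2
  have := isDiagram_of_decomposition (M := persistentHomology k (paramRange a b) w n)
    (fun j : bars π w => lifeSpan (paramRange a b) (w j) ((π.death j).map w))
    (fun j => (hend j).1)
    (fun t => (Submodule.quotEquivOfEq _ _ (ker_aliveCoord (paramRange a b) π hw t).symm).trans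
      (LinearMap.quotKerEquivOfSurjective _ (aliveCoord_surjective (paramRange a b) π hw t)))
    (fun s t f x j => by
      obtain ⟨z, rfl⟩ := Submodule.Quotient.mk_surjective _ x
      exact aliveCoord_naturality (paramRange a b) π hw (leOfHom f) z j)
  convert this using 2
  exact (hend _).2.symm

theorem diagram_eq (hw : Monotone w) (hab : ∀ σ, w σ ∈ Set.Icc a b) [Fintype (bars π w)] :
    diagram k (paramRange a b) w n =
      Finset.univ.val.map fun j : bars π w => lifePoint a b (w j) ((π.death j).map w) :=
  (isDiagram_persistentHomology π hw hab).dgm_eq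

end Diagram

/-! ### Stability -/

section Stability

section Cost

variable {X : Type v} [TopologicalSpace X] {C : Set X} [CWComplex C] {k : Type u} [Field k]
  {a b : ℝ} {w v : Cells C → ℝ}

/-- The distance of the end points of two corresponding life spans. -/
def deathCost (k : Type u) [Field k] (P : Set ℝ) (w v : Cells C → ℝ) (d : WithTop (Cells C)) : ℝ≥0∞ :=
  -- Immortal bars end at `2b - a` for both weights, so their deaths cost nothing.
  (d.map fun q => dRkFree k P (w q) (v q)).untopD 0

theorem dRk_lifePoint_le (hab : ∀ σ, w σ ∈ Set.Icc a b) (hab' : ∀ σ, v σ ∈ Set.Icc a b)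
    (p : Cells C) (d : WithTop (Cells C)) :
    dRk (intervalModule k (pointInterval (paramRange a b) (some (lifePoint a b (w p) (d.map w)))))
      (intervalModule k (pointInterval (paramRange a b) (some (lifePoint a b (v p) (d.map v))))) ≤
      dRkFree k (paramRange a b) (w p) (v p) + deathCost k (paramRange a b) w v d := by
  induction d using WithTop.recTopCoe with
  | top => exact (dRk_pointInterval_top k (hab p).1 (hab' p).1).le.trans le_self_add
  | coe q => exact dRk_pointInterval_le k (hab p).1 (hab' p).1 (hab q) (hab' q)

end Cost

variable {X : Type v} [TopologicalSpace X] [T2Space X] {C : Set X} [CWComplex C]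
  [CWComplex.Finite C] {k : Type u} [Field k] [L : LinearOrder (Cells C)] {n : ℕ} {a b : ℝ}
  (π : CellPairing k C n) {w v : Cells C → ℝ}

/-- The coupling matches the two bars with the same birth cell; nothing is matched with the
diagonal. -/
theorem W1_diagram_le_sum (hw : Monotone w) (hv : Monotone v) (hab : ∀ σ, w σ ∈ Set.Icc a b)
    (hab' : ∀ σ, v σ ∈ Set.Icc a b) (hwv : Compatible w v) [Fintype (bars π w)] :
    W1 k (paramRange a b) (diagram k (paramRange a b) w n) (diagram k (paramRange a b) v n) ≤
      ∑ j : bars π w, (dRkFree k (paramRange a b) (w j) (v j) +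
        deathCost k (paramRange a b) w v (π.death j)) := by
  have hbars := bars_eq_of_compatible π hwv
  have hdv : diagram k (paramRange a b) v n = Finset.univ.val.map
      fun j : bars π w => lifePoint a b (v j) ((π.death j).map v) := by
    let _ : Fintype (bars π v) := Fintype.ofEquiv (bars π w) (Equiv.setCongr hbars)
    rw [diagram_eq π hv hab']
    have : ∀ (A B : Set (Cells C)) [Fintype A] [Fintype B], A = B →
        (Finset.univ.val.map fun j : A => lifePoint a b (v j) ((π.death j).map v)) =
        Finset.univ.val.map fun j : B => lifePoint a b (v j) ((π.death j).map v) := by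
      rintro A B _ _ rfl
      congr!
    exact this _ _ hbars.symm
  rw [diagram_eq π hw hab, hdv]
  refine (iInf₂_le (Finset.univ.val.map fun j : bars π w =>
    (some (lifePoint a b (w j) ((π.death j).map w)),
      some (lifePoint a b (v j) ((π.death j).map v)))) ?_).trans ?_
  · refine ⟨?_, ?_, ?_⟩
    · rw [Multiset.filterMap_map]
      exact congrFun (Multiset.filterMap_eq_map _) _
    · rw [Multiset.filterMap_map]
      exact congrFun (Multiset.filterMap_eq_map _) _
    · simp
  · rw [cost, Multiset.map_map]
    exact Finset.sum_le_sum fun j _ => dRk_lifePoint_le hab hab' j (π.death j)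

open Classical in
-- Distinct bars have distinct death cells, so each cell is charged at most once.
theorem sum_deathCost_le [Fintype (Cells C)] (hw : Monotone w) [Fintype (bars π w)] (P : Set ℝ) :
    ∑ j : bars π w, deathCost k P w v (π.death j) ≤
      ∑ q : Cells C, if ∃ j ∈ bars π w, π.death j = q then dRkFree k P (w q) (v q) else 0 := by
  have h1 : ∀ d : WithTop (Cells C),
      deathCost k P w v d = ∑ q : Cells C, if d = q then dRkFree k P (w q) (v q) else 0 := by
    intro d
    induction d using WithTop.recTopCoe with
    | top => simp [deathCost]
    | coe r => simp [deathCost]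
  simp only [h1]
  rw [Finset.sum_comm]
  refine Finset.sum_le_sum fun q _ => ?_
  split_ifs with hq
  · obtain ⟨p, hp, hpq⟩ := hq
    have hlt := hw.reflect_lt (((mem_bars_iff π w p).1 hp).2 q hpq)
    rw [Finset.sum_eq_single (⟨p, hp⟩ : bars π w)]
    · rw [if_pos hpq]
    · rintro ⟨j, hj⟩ - hne
      exact if_neg fun hjq => hne
        (Subtype.ext (π.death_injective (isCellwise k n) hp.1 hj.1 hlt hpq hjq).symm)
    · exact fun h => absurd (Finset.mem_univ _) h
  · exact (Finset.sum_eq_zero fun ⟨j, hj⟩ _ => if_neg fun hjq => hq ⟨j, hj, hjq⟩).le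

/-- The stability theorem in one degree. -/
theorem W1_diagram_le (hw : Monotone w) (hv : Monotone v) (hab : ∀ σ, w σ ∈ Set.Icc a b)
    (hab' : ∀ σ, v σ ∈ Set.Icc a b) (hwv : Compatible w v) :
    W1 k (paramRange a b) (diagram k (paramRange a b) w n) (diagram k (paramRange a b) v n) ≤
      ∑' σ : {σ : Cells C // IsBirthCell k L n σ ∨ IsDeathCell k L n σ},
        dRkFree k (paramRange a b) (w σ) (v σ) := by
  classical
  have : _root_.Finite (Cells C) := RelCWComplex.finite_cells_of_finite
  let _ := Fintype.ofFinite (Cells C)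
  obtain ⟨π⟩ := (isCellwise (C := C) k n).nonempty_pairing
  refine (W1_diagram_le_sum π hw hv hab hab' hwv).trans ?_
  rw [Finset.sum_add_distrib]
  refine (add_le_add_right (sum_deathCost_le π hw _) _).trans ?_
  have h1 : ∑ j : bars π w, dRkFree k (paramRange a b) (w j) (v j) =
      ∑ q, if q ∈ bars π w then dRkFree k (paramRange a b) (w q) (v q) else 0 := by
    rw [← Finset.sum_filter]
    exact (Finset.sum_subtype (Finset.univ.filter (· ∈ bars π w)) (fun q => by simp)
      fun q => dRkFree k (paramRange a b) (w q) (v q)).symm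
  rw [h1, ← Finset.sum_add_distrib]
  refine le_of_le_of_eq ?_ (tsum_subtype {σ : Cells C | IsBirthCell k L n σ ∨ IsDeathCell k L n σ}
    fun σ => dRkFree k (paramRange a b) (w σ) (v σ)).symm
  rw [tsum_fintype]
  refine Finset.sum_le_sum fun q _ => ?_
  have hlt : ∀ p ∈ bars π w, ∀ q : Cells C, π.death p = q → p < q := fun p hp q hpq =>
    hw.reflect_lt (((mem_bars_iff π w p).1 hp).2 q hpq)
  -- No cell both starts one bar and ends another, so at most one of the two summands at `q` is
  -- present.
  by_cases hb : q ∈ bars π w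
  · have hd : ¬ ∃ j ∈ bars π w, π.death j = q := fun ⟨j, hj, hjq⟩ =>
      π.notMem_births (isCellwise k n) hj.1 (hlt j hj q hjq) hjq hb.1
    have hq : q ∈ {σ : Cells C | IsBirthCell k L n σ ∨ IsDeathCell k L n σ} :=
      Or.inl (isBirthCell_of_mem_births π hb.1 (hlt q hb))
    rw [if_pos hb, if_neg hd, add_zero, Set.indicator_of_mem hq]
  · rw [if_neg hb, zero_add]
    split_ifs with hd
    · obtain ⟨j, hj, hjq⟩ := hd
      have hq : q ∈ {σ : Cells C | IsBirthCell k L n σ ∨ IsDeathCell k L n σ} :=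
        Or.inr (isDeathCell_of_death_eq π hj.1 (hlt j hj q hjq) hjq)
      rw [Set.indicator_of_mem hq]
    · exact zero_le

/-- After exchanging the sums, each cell contributes in at most one degree by `degree_unique`. -/
theorem tsum_birth_death_le (f : Cells C → ℝ≥0∞) :
    ∑' i, ∑' σ : {σ : Cells C // IsBirthCell k L i σ ∨ IsDeathCell k L i σ}, f σ ≤ ∑' σ, f σ := by
  have h1 : ∀ i, ∑' σ : {σ : Cells C // IsBirthCell k L i σ ∨ IsDeathCell k L i σ}, f σ =
      ∑' σ, {σ : Cells C | IsBirthCell k L i σ ∨ IsDeathCell k L i σ}.indicator f σ :=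
    fun i => tsum_subtype {σ : Cells C | IsBirthCell k L i σ ∨ IsDeathCell k L i σ} f
  simp only [h1]
  rw [ENNReal.tsum_comm]
  refine ENNReal.tsum_le_tsum fun σ => ?_
  by_cases h : ∃ i, IsBirthCell k L i σ ∨ IsDeathCell k L i σ
  · obtain ⟨i, hi⟩ := h
    rw [tsum_eq_single i fun j hj => Set.indicator_of_notMem
      (s := {σ : Cells C | IsBirthCell k L j σ ∨ IsDeathCell k L j σ})
      (fun hm => hj (degree_unique k hm hi)) f]
    exact Set.indicator_le_self _ _ _
  · push Not at h
    have h0 : ∀ i, {σ : Cells C | IsBirthCell k L i σ ∨ IsDeathCell k L i σ}.indicator f σ = 0 :=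
      fun i => Set.indicator_of_notMem (fun hm => hm.elim (h i).1 (h i).2) f
    simp only [h0, tsum_zero]
    exact zero_le

variable (n) in
theorem isDiagram_diagram (hw : Monotone w) (hab : ∀ σ, w σ ∈ Set.Icc a b) :
    IsDiagram (persistentHomology k (paramRange a b) w n) (diagram k (paramRange a b) w n) := by
  have : _root_.Finite (Cells C) := RelCWComplex.finite_cells_of_finite
  obtain ⟨π⟩ := (isCellwise (C := C) k n).nonempty_pairing
  let _ := Fintype.ofFinite (bars π w)
  rw [diagram_eq π hw hab]
  exact isDiagram_persistentHomology π hw hab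

end Stability

end RankStability

end

open RankStability Topology in
theorem mainTheorem11 {k : Type*} [Field k] {X : Type*} [TopologicalSpace X] [T2Space X]
    (C : Set X) [CWComplex C] [CWComplex.Finite C] (a b : ℝ) (w v : Cells C → ℝ)
    (hw : IsWeight a b w) (hv : IsWeight a b v) (hwv : Compatible w v) :
    -- the homology modules decompose into intervals, so that the diagrams are defined
    (∀ i, IsDiagram (persistentHomology k (paramRange a b) w i) (diagram k (paramRange a b) w i) ∧
      IsDiagram (persistentHomology k (paramRange a b) v i) (diagram k (paramRange a b) v i)) ∧
    -- all degrees
    ∑' i, W1 k (paramRange a b) (diagram k (paramRange a b) w i) (diagram k (paramRange a b) v i) ≤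
      ∑' σ, dRkFree k (paramRange a b) (w σ) (v σ) ∧
    -- one degree: birth and death cells with respect to any total order respecting `w` and `v`
    (∃ L : LinearOrder (Cells C), Respects L w ∧ Respects L v) ∧
    ∀ L : LinearOrder (Cells C), Respects L w → Respects L v → ∀ i,
      W1 k (paramRange a b) (diagram k (paramRange a b) w i) (diagram k (paramRange a b) v i) ≤
        ∑' σ : {σ : Cells C // IsBirthCell k L i σ ∨ IsDeathCell k L i σ},
          dRkFree k (paramRange a b) (w σ) (v σ) := by
  have hmono : ∀ (L : LinearOrder (Cells C)) (w : Cells C → ℝ), Respects L w → Monotone w :=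
    fun L w h σ τ => h.2 σ τ
  obtain ⟨L, hLw, hLv⟩ := exists_respects hw hwv
  refine ⟨fun i => ⟨isDiagram_diagram i (hmono L w hLw) hw.1,
    isDiagram_diagram i (hmono L v hLv) hv.1⟩, ?_, ⟨L, hLw, hLv⟩,
    fun L hLw hLv i => W1_diagram_le (hmono L w hLw) (hmono L v hLv) hw.1 hv.1 hwv⟩
  -- The same order `L` serves in every degree, so that each cell is counted only once overall.
  exact (ENNReal.tsum_le_tsum fun i => W1_diagram_le (hmono L w hLw) (hmono L v hLv) hw.1 hv.1
    hwv).trans (tsum_birth_death_le (k := k) _)
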